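/- Let $d_A,d_B\in\mathbb{N}$, $\mathcal{H}_A=\mathbb{C}^{d_A}$, $\mathcal{H}_B=\mathbb{C}^{d_B}$. A property of bipartite pure states is a pair $\mathcal{P}=(\mathcal{P}^{\mathrm{yes}},\mathcal{P}^{\mathrm{no}})$ of disjoint sets of unit vectors in $\mathcal{H}_A\otimes\mathcal{H}_B$. It is a property of the entanglement spectrum if membership of $|\psi\rangle$ in $\mathcal{P}^{\mathrm{yes}}$, and in $\mathcal{P}^{\mathrm{no}}$, depends only on the multiset of nonzero Schmidt coefficients $\lambda_j$ in a Schmidt decomposition $|\psi\rangle=\sum_j\lambda_j|\phi_j\rangle_A|\gamma_j\rangle_B$ ($\lambda_j>0$, with $\{|\phi_j\rangle\}$ and $\{|\gamma_j\rangle\}$ orthonormal). For $0\le s<c\le 1$, a $(c,s)$-tester for $\mathcal{P}$ with sample complexity $N$ is an operator $0\sqsubseteq\mathcal{T}\sqsubseteq I$ on $(\mathcal{H}_A\otimes\mathcal{H}_B)^{\otimes N}$ such that $\mathrm{tr}[\mathcal{T}|\psi\rangle\langle\psi|^{\otimes N}]\ge c$ for all $|\psi\rangle\in\mathcal{P}^{\mathrm{yes}}$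 and $\mathrm{tr}[\mathcal{T}|\psi\rangle\langle\psi|^{\otimes N}]\le s$ for all $|\psi\rangle\in\mathcal{P}^{\mathrm{no}}$. The sample complexity $\mathsf{S}_{c,s}(\mathcal{P})$ is the minimum $N$ over all (possibly global) $(c,s)$-testers for $\mathcal{P}$, and is $\infty$ if there are none. Weak Schur sampling on $(\mathbb{C}^d)^{\otimes N}$ is the measurement $\{\Pi_\lambda\}$ whose outcomes are the Young diagrams $\lambda$ with $N$ boxes and at most $d$ rows, where $\Pi_\lambda$ is the orthogonal projector onto the summand $\mathcal{V}_\lambda\otimes\mathcal{W}_\lambda$ of the Schur–Weyl decomposition, i.e. onto the isotypic component of the irreducible representation $\mathcal{V}_\lambda$ of the symmetric group $\mathbb{S}_N$ (the Specht module), $\mathbb{S}_N$ acting by permutation of the tensor factors. A tester $\mathcal{T}$ consists of locally performing weak Schur sampling on $A$ and classically postprocessing the outcome if $\mathcal{T}=\big(\sum_\lambda f(\lambda)\,\Pi_\lambda\big)_A\otimes I_B$, where $\{\Pi_\lambda\}$ is weak Schur sampling on $\mathcal{H}_A^{\otimes N}$ and $f(\lambda)\in[0,1]$ is the probability of accepting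 on outcome $\lambda$. **Corollary 1.4.** Let $\mathcal{P}$ be a property of the entanglement spectrum of bipartite pure states and let $0\le s<c\le 1$. For every $N$ such that $\mathcal{P}$ has a (possibly global) $(c,s)$-tester with sample complexity $N$, $\mathcal{P}$ also has a $(c,s)$-tester with sample complexity $N$ that consists of locally performing weak Schur sampling on $A$ and classically postprocessing the outcome. In particular, if $\mathcal{P}$ has any $(c,s)$-tester, then there is a $(c,s)$-tester of this canonical form whose sample complexity is $\mathsf{S}_{c,s}(\mathcal{P})$. -/

import Mathlib

open scoped Kronecker ComplexOrder

noncomputable section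

/-! ### Bipartite pure states and their entanglement spectrum -/

/-- The bipartite space `ℂ^dA ⊗ ℂ^dB`, in coordinates with respect to the product of the standard
bases: the vector `φ ⊗ γ` has coordinates `(a, b) ↦ φ a * γ b`. -/
abbrev BipartiteSpace (dA dB : ℕ) : Type := EuclideanSpace ℂ (Fin dA × Fin dB)

/-- `ψ = ∑ⱼ coef j • (φ j ⊗ γ j)` is a Schmidt decomposition of `ψ`: the families `φ` and `γ` are
orthonormal and the Schmidt coefficients are positive (vanishing terms are omitted). -/
def IsSchmidtDecomposition {dA dB r : ℕ} (ψ : BipartiteSpace dA dB) (coef : Fin r → ℝ)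
    (φ : Fin r → EuclideanSpace ℂ (Fin dA)) (γ : Fin r → EuclideanSpace ℂ (Fin dB)) : Prop :=
  Orthonormal ℂ φ ∧ Orthonormal ℂ γ ∧ (∀ j, 0 < coef j) ∧
    ∀ a b, ψ (a, b) = ∑ j, (coef j : ℂ) * (φ j a * γ j b)

/-- The multiset `S` is the entanglement spectrum of `ψ`: the nonzero Schmidt coefficients of `ψ`,
counted with multiplicity. -/
def HasEntanglementSpectrum {dA dB : ℕ} (ψ : BipartiteSpace dA dB) (S : Multiset ℝ) : Prop :=
  ∃ (r : ℕ) (coef : Fin r → ℝ) (φ : Fin r → EuclideanSpace ℂ (Fin dA))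
    (γ : Fin r → EuclideanSpace ℂ (Fin dB)),
    IsSchmidtDecomposition ψ coef φ γ ∧ S = Finset.univ.val.map coef

/-- A property of bipartite pure states: two disjoint sets of unit vectors. -/
structure PureStateProperty (dA dB : ℕ) where
  yes : Set (BipartiteSpace dA dB)
  no : Set (BipartiteSpace dA dB)
  norm_eq_one : ∀ ψ ∈ yes ∪ no, ‖ψ‖ = 1
  disjoint : Disjoint yes no

/-- A property of the entanglement spectrum: whether a state belongs to the yes-set, or to the
no-set, depends only on its entanglement spectrum. -/
def PureStateProperty.IsEntanglementSpectrumProperty {dA dB : ℕ}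
    (P : PureStateProperty dA dB) : Prop :=
  ∀ (ψ φ : BipartiteSpace dA dB) (S : Multiset ℝ),
    HasEntanglementSpectrum ψ S → HasEntanglementSpectrum φ S →
      (ψ ∈ P.yes → φ ∈ P.yes) ∧ (ψ ∈ P.no → φ ∈ P.no)

/-! ### Testers and sample complexity -/

/-- The density operator `|ψ⟩⟨ψ|`. -/
def pureDensity {ι : Type*} (ψ : EuclideanSpace ℂ ι) : Matrix ι ι ℂ :=
  Matrix.of fun x y => ψ x * star (ψ y)

/-- The tensor power `ρ^{⊗N}`; the standard basis of the `N`-th tensor power of `ℂ^ι` is indexed by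
the words `Fin N → ι`. -/
def tensorPower {ι : Type*} (ρ : Matrix ι ι ℂ) (N : ℕ) : Matrix (Fin N → ι) (Fin N → ι) ℂ :=
  Matrix.of fun x y => ∏ i, ρ (x i) (y i)

/-- Operators on `(ℂ^dA ⊗ ℂ^dB)^{⊗N}`. -/
abbrev GlobalOperator (dA dB N : ℕ) : Type :=
  Matrix (Fin N → Fin dA × Fin dB) (Fin N → Fin dA × Fin dB) ℂ

/-- The probability `tr[T |ψ⟩⟨ψ|^{⊗N}]` that `T` accepts `N` copies of `ψ`. -/
def acceptProb {dA dB N : ℕ} (T : GlobalOperator dA dB N) (ψ : BipartiteSpace dA dB) : ℝ :=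
  (T * tensorPower (pureDensity ψ) N).trace.re

/-- `T` (with `0 ≤ T ≤ 1` in the Löwner order) is a `(c, s)`-tester for `P` with sample
complexity `N`. -/
def IsTester {dA dB : ℕ} (P : PureStateProperty dA dB) (c s : ℝ) (N : ℕ)
    (T : GlobalOperator dA dB N) : Prop :=
  T.PosSemidef ∧ (1 - T).PosSemidef ∧
    (∀ ψ ∈ P.yes, c ≤ acceptProb T ψ) ∧ (∀ ψ ∈ P.no, acceptProb T ψ ≤ s)

/-- The `(c, s)`-sample complexity of `P`: the minimum sample complexity over all (global)
`(c, s)`-testers for `P`; it is `⊤` if there is no such tester. -/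
def sampleComplexity {dA dB : ℕ} (P : PureStateProperty dA dB) (c s : ℝ) : ℕ∞ :=
  sInf {n : ℕ∞ | ∃ (N : ℕ) (T : GlobalOperator dA dB N), n = N ∧ IsTester P c s N T}

/-- The operator `M ⊗ 1` on `(ℂ^dA ⊗ ℂ^dB)^{⊗N} ≅ (ℂ^dA)^{⊗N} ⊗ (ℂ^dB)^{⊗N}` that acts as `M` on
the `N` systems of the first party and trivially on those of the second. -/
def localOperator {dA N : ℕ} (dB : ℕ) (M : Matrix (Fin N → Fin dA) (Fin N → Fin dA) ℂ) :
    GlobalOperator dA dB N :=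
  (M ⊗ₖ (1 : Matrix (Fin N → Fin dB) (Fin N → Fin dB) ℂ)).submatrix
    (fun x => (fun i => (x i).1, fun i => (x i).2)) (fun x => (fun i => (x i).1, fun i => (x i).2))

/-! ### Measurements and classical postprocessing -/

/-- `E` is a measurement (POVM) with finite outcome set `Ω`. -/
def IsMeasurement {Ω n : Type*} [Fintype Ω] [DecidableEq n] (E : Ω → Matrix n n ℂ) : Prop :=
  (∀ ω, (E ω).PosSemidef) ∧ ∑ ω, E ω = 1

/-- `M` is the accepting operator of the procedure that performs the measurement `E` and
postprocesses its outcome classically: on outcome `ω` it accepts with probability `f ω`. -/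
def IsPostprocessedMeasurement {Ω n : Type*} [Fintype Ω] [DecidableEq n]
    (E : Ω → Matrix n n ℂ) (M : Matrix n n ℂ) : Prop :=
  IsMeasurement E ∧ ∃ f : Ω → ℝ, (∀ ω, 0 ≤ f ω ∧ f ω ≤ 1) ∧ M = ∑ ω, (f ω : ℂ) • E ω

/-! ### Young diagrams and the irreducible representations of the symmetric group -/

/-- Young diagrams with `N` boxes and at most `d` rows. -/
def BoundedDiagram (N d : ℕ) : Type := {μ : YoungDiagram // μ.card = N ∧ μ.colLen 0 ≤ d}

instance (N d : ℕ) : Finite (BoundedDiagram N d) := by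
  have key : ∀ μ : BoundedDiagram N d,
      μ.1.cells ∈ (Finset.range N ×ˢ Finset.range N).powerset := by
    rintro ⟨μ, hN, -⟩
    rw [Finset.mem_powerset]
    rintro ⟨i, j⟩ hij
    have h1 : μ.colLen j ≤ N := by
      rw [YoungDiagram.colLen_eq_card, ← hN]
      exact Finset.card_le_card (Finset.filter_subset _ _)
    have h2 : μ.rowLen i ≤ N := by
      rw [YoungDiagram.rowLen_eq_card, ← hN]
      exact Finset.card_le_card (Finset.filter_subset _ _)
    have h3 := YoungDiagram.mem_iff_lt_colLen.1 ((YoungDiagram.mem_cells _).1 hij)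
    have h4 := YoungDiagram.mem_iff_lt_rowLen.1 ((YoungDiagram.mem_cells _).1 hij)
    exact Finset.mem_product.2
      ⟨Finset.mem_range.2 (h3.trans_le h1), Finset.mem_range.2 (h4.trans_le h2)⟩
  refine Finite.of_injective
    (fun μ : BoundedDiagram N d =>
      (⟨μ.1.cells, key μ⟩ : ↥(Finset.range N ×ˢ Finset.range N).powerset)) ?_
  intro μ ν h
  exact Subtype.ext (YoungDiagram.ext (congrArg Subtype.val h))

instance (N d : ℕ) : Fintype (BoundedDiagram N d) := Fintype.ofFinite _

/-- The complex group algebra of the symmetric group on `N` letters. -/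
abbrev SymAlgebra (N : ℕ) : Type := MonoidAlgebra ℂ (Equiv.Perm (Fin N))

/-- A filling of the boxes of `μ` by the numbers `0, …, N - 1`, each used once; it sends a number to
the (row, column) position of its box. -/
abbrev Tableau (N : ℕ) (μ : YoungDiagram) : Type := Fin N ≃ {x // x ∈ μ.cells}

open Classical in
/-- The Young symmetrizer of the tableau `t`: the sum of the permutations that preserve every row
of `t`, times the signed sum of the permutations that preserve every column of `t`. -/
def youngSymmetrizer {N : ℕ} {μ : YoungDiagram} (t : Tableau N μ) : SymAlgebra N :=
  (∑ p : Equiv.Perm (Fin N) with ∀ i, (t (p i)).1.1 = (t i).1.1, MonoidAlgebra.single p (1 : ℂ)) *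
    ∑ q : Equiv.Perm (Fin N) with ∀ i, (t (q i)).1.2 = (t i).1.2,
      MonoidAlgebra.single q ((Equiv.Perm.sign q : ℤ) : ℂ)

/-- The irreducible representation `V_μ` of the symmetric group (the Specht module): the left ideal
of the group algebra generated by a Young symmetrizer of shape `μ`. The tableau is an arbitrary
fixed one, since tableaux of the same shape give isomorphic left ideals. -/
def spechtModule {N : ℕ} (μ : YoungDiagram) (h : μ.card = N) :
    Submodule (SymAlgebra N) (SymAlgebra N) :=
  Submodule.span (SymAlgebra N) {youngSymmetrizer (μ.cells.equivFinOfCardEq h).symm}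

/-! ### Weak Schur sampling -/

/-- The action of the symmetric group on `(ℂ^d)^{⊗N}` by permutation of the tensor factors,
`P(π) |x₁ … x_N⟩ = |x_{π⁻¹(1)} … x_{π⁻¹(N)}⟩`. -/
def permRep (N d : ℕ) :
    Representation ℂ (Equiv.Perm (Fin N)) (EuclideanSpace ℂ (Fin N → Fin d)) where
  toFun π :=
    { toFun := fun v => WithLp.toLp 2 fun x => v (x ∘ π)
      map_add' := fun _ _ => rfl
      map_smul' := fun _ _ => rfl }
  map_one' := rfl
  map_mul' _ _ := rfl

/-- The summand `V_μ ⊗ W_μ` in the Schur-Weyl decomposition of `(ℂ^d)^{⊗N}`: the isotypic component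
of the irreducible representation `V_μ` of the symmetric group. -/
def schurWeylSummand {N d : ℕ} (μ : BoundedDiagram N d) :
    Submodule ℂ (EuclideanSpace ℂ (Fin N → Fin d)) :=
  ((isotypicComponent (SymAlgebra N) (permRep N d).asModule
    (spechtModule μ.1 μ.2.1)).restrictScalars ℂ).map (permRep N d).asModuleEquiv.toLinearMap

/-- Weak Schur sampling on `(ℂ^d)^{⊗N}`: the measurement whose outcome is a Young diagram `μ` with
`N` boxes and at most `d` rows, given by the orthogonal projections onto the summands `V_μ ⊗ W_μ` of
the Schur-Weyl decomposition. -/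
def weakSchurSampling (N d : ℕ) (μ : BoundedDiagram N d) :
    Matrix (Fin N → Fin d) (Fin N → Fin d) ℂ :=
  (Matrix.toEuclideanCLM (n := Fin N → Fin d) (𝕜 := ℂ)).symm (schurWeylSummand μ).starProjection

/-- `T` consists of performing weak Schur sampling locally, on the `N` systems of the first party,
and classically postprocessing the outcome. -/
def IsLocalWeakSchurTester {dA dB N : ℕ} (T : GlobalOperator dA dB N) : Prop :=
  ∃ M, IsPostprocessedMeasurement (weakSchurSampling N dA) M ∧ T = localOperator dB M

end

/-! A local unitary `U ⊗ V` preserves the entanglement spectrum, so conjugating a tester by `(U ⊗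
V)^{⊗N}` gives another tester. The testers form a closed convex set; its element of least Frobenius
norm is unique, hence fixed by all these conjugations. This replaces Haar averaging
(`exists_mem_forall_conj_eq`, `exists_isTester_commute`).

By Schur-Weyl duality on each side, a tester commuting with all `U^{⊗N} ⊗ V^{⊗N}` is a linear
combination of pairs `(π, σ)` of permutations of the A-factors and of the B-factors
(`exists_mulVec_eq_sum_perm`). On the symmetric subspace, which contains `ψ^{⊗N}`, permuting B by
`σ` is the same as permuting A by `σ⁻¹`, so only an element of the group algebra acting on A
remains. Symmetry also allows averaging it over conjugates, so it may be taken central; a central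
element acts as a scalar on each isotypic component (`exists_dotProduct_mulVec_eq_sum`). Thus the
tester agrees on the states `ψ^{⊗N}` with a combination of the projections `Π_μ ⊗ 1`, and `0 ≤ T ≤
1` puts the relevant scalars in `[0, 1]` (`exists_acceptance_probabilities`).

Weak Schur sampling must also be shown to be a measurement, that is, the isotypic components of the
Specht modules must be orthogonal and span. This needs the classification of the irreducible
representations of the symmetric group: Specht modules are simple and pairwise non-isomorphic by the
combinatorics of Young symmetrizers, and exhaust the simple modules because there are as many
diagrams as conjugacy classes (`exists_linearEquiv_spechtModule`). Diagrams with more than `d` rows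
do not occur in `(ℂ^d)^{⊗N}`, since antisymmetrizing more than `d` factors gives zero. -/

noncomputable section

/-! ### Row sums and signed column sums in the group algebra -/

/-- The permutations that preserve every fibre of `κ`. -/
def fiberPerms {N : ℕ} (κ : Fin N → ℕ) : Finset (Equiv.Perm (Fin N)) :=
  {p | ∀ i, κ (p i) = κ i}

/-- The sum of the permutations that preserve every fibre of `κ`. -/
def fiberSum {N : ℕ} (κ : Fin N → ℕ) : SymAlgebra N :=
  ∑ p ∈ fiberPerms κ, MonoidAlgebra.single p (1 : ℂ)

/-- The signed sum of the permutations that preserve every fibre of `κ`. -/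
def signedFiberSum {N : ℕ} (κ : Fin N → ℕ) : SymAlgebra N :=
  ∑ q ∈ fiberPerms κ, MonoidAlgebra.single q ((Equiv.Perm.sign q : ℤ) : ℂ)

/-- The row of the box of `t` that contains a given number. -/
def rowOf {N : ℕ} {μ : YoungDiagram} (t : Tableau N μ) (i : Fin N) : ℕ := (t i).1.1

/-- The column of the box of `t` that contains a given number. -/
def colOf {N : ℕ} {μ : YoungDiagram} (t : Tableau N μ) (i : Fin N) : ℕ := (t i).1.2

theorem youngSymmetrizer_eq {N : ℕ} {μ : YoungDiagram} (t : Tableau N μ) :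
    youngSymmetrizer t = fiberSum (rowOf t) * signedFiberSum (colOf t) := by
  unfold youngSymmetrizer fiberSum signedFiberSum fiberPerms rowOf colOf
  congr!

theorem mem_fiberPerms {N : ℕ} {κ : Fin N → ℕ} {p : Equiv.Perm (Fin N)} :
    p ∈ fiberPerms κ ↔ ∀ i, κ (p i) = κ i := by
  simp [fiberPerms]

theorem mul_mem_fiberPerms {N : ℕ} {κ : Fin N → ℕ} {p q : Equiv.Perm (Fin N)}
    (hp : p ∈ fiberPerms κ) (hq : q ∈ fiberPerms κ) : p * q ∈ fiberPerms κ := by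
  rw [mem_fiberPerms] at *
  intro i
  rw [Equiv.Perm.mul_apply, hp, hq]

theorem inv_mem_fiberPerms {N : ℕ} {κ : Fin N → ℕ} {p : Equiv.Perm (Fin N)}
    (hp : p ∈ fiberPerms κ) : p⁻¹ ∈ fiberPerms κ := by
  rw [mem_fiberPerms] at *
  intro i
  rw [← hp (p⁻¹ i)]
  simp

theorem swap_mem_fiberPerms {N : ℕ} {κ : Fin N → ℕ} {i j : Fin N} (h : κ i = κ j) :
    Equiv.swap i j ∈ fiberPerms κ := by
  rw [mem_fiberPerms]
  intro k
  rw [Equiv.swap_apply_def]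
  split_ifs <;> simp_all

theorem fiberSum_mul_single {N : ℕ} {κ : Fin N → ℕ} {p : Equiv.Perm (Fin N)}
    (hp : p ∈ fiberPerms κ) : fiberSum κ * MonoidAlgebra.single p 1 = fiberSum κ := by
  unfold fiberSum
  rw [Finset.sum_mul]
  refine Finset.sum_bij' (fun q _ => q * p) (fun q _ => q * p⁻¹)
    (fun q hq => mul_mem_fiberPerms hq hp)
    (fun q hq => mul_mem_fiberPerms hq (inv_mem_fiberPerms hp)) ?_ ?_ ?_
  · simp
  · simp
  · intro q _
    rw [MonoidAlgebra.single_mul_single, mul_one]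

theorem single_mul_signedFiberSum {N : ℕ} {κ : Fin N → ℕ} {p : Equiv.Perm (Fin N)}
    (hp : p ∈ fiberPerms κ) : MonoidAlgebra.single p (1 : ℂ) * signedFiberSum κ =
      ((Equiv.Perm.sign p : ℤ) : ℂ) • signedFiberSum κ := by
  unfold signedFiberSum
  rw [Finset.mul_sum, Finset.smul_sum]
  refine Finset.sum_bij' (fun q _ => p * q) (fun q _ => p⁻¹ * q)
    (fun q hq => mul_mem_fiberPerms hp hq)
    (fun q hq => mul_mem_fiberPerms (inv_mem_fiberPerms hp) hq) ?_ ?_ ?_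
  · simp
  · simp
  · intro q _
    rw [MonoidAlgebra.single_mul_single, MonoidAlgebra.smul_single, one_mul]
    congr 1
    rcases Int.units_eq_one_or (Equiv.Perm.sign p) with h | h <;> simp [h]

theorem single_mul_signedFiberSum_comm {N : ℕ} (κ : Fin N → ℕ) (g : Equiv.Perm (Fin N)) :
    MonoidAlgebra.single g (1 : ℂ) * signedFiberSum κ =
      signedFiberSum (fun i => κ (g⁻¹ i)) * MonoidAlgebra.single g 1 := by
  unfold signedFiberSum
  rw [Finset.mul_sum, Finset.sum_mul]
  refine Finset.sum_bij' (fun q _ => g * q * g⁻¹) (fun q _ => g⁻¹ * q * g) ?_ ?_ ?_ ?_ ?_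
  · intro q hq
    rw [mem_fiberPerms] at *
    intro i
    simp [hq]
  · intro q hq
    rw [mem_fiberPerms] at *
    intro i
    simpa using hq (g i)
  · intro q _
    group
  · intro q _
    group
  · intro q _
    rw [MonoidAlgebra.single_mul_single, MonoidAlgebra.single_mul_single, one_mul, mul_one]
    congr 1
    · group
    · rcases Int.units_eq_one_or (Equiv.Perm.sign g) with h | h <;> simp [h]

/-- The transposition of `i` and `j` can be inserted between the factors: the left one absorbs it,
the right one turns it into a sign. -/
theorem fiberSum_mul_signedFiberSum_eq_zero {N : ℕ} {κ κ' : Fin N → ℕ} {i j : Fin N} (hij : i ≠ j)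
    (h : κ i = κ j) (h' : κ' i = κ' j) : fiberSum κ * signedFiberSum κ' = 0 := by
  have h1 : fiberSum κ * signedFiberSum κ' = -(fiberSum κ * signedFiberSum κ') := by
    conv_lhs => rw [← fiberSum_mul_single (swap_mem_fiberPerms h), mul_assoc,
      single_mul_signedFiberSum (swap_mem_fiberPerms h'), Equiv.Perm.sign_swap hij]
    simp
  have h2 : (2 : ℂ) • (fiberSum κ * signedFiberSum κ') = 0 := by
    rw [two_smul]
    exact add_eq_zero_iff_eq_neg.2 h1
  exact (smul_eq_zero.1 h2).resolve_left two_ne_zero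

/-! ### Fillings without a pair of numbers in a common row and a common column -/

/-- The number of boxes of `μ` in the first `k` columns. -/
def colCount (μ : YoungDiagram) (k : ℕ) : ℕ := {x ∈ μ.cells | x.2 < k}.card

/-- The number of boxes of `μ` in row `a` and the first `k` columns. -/
def rowColCount (μ : YoungDiagram) (a k : ℕ) : ℕ := {x ∈ μ.cells | x.1 = a ∧ x.2 < k}.card

theorem rowColCount_eq (μ : YoungDiagram) (a k : ℕ) :
    rowColCount μ a k = min (μ.rowLen a) k := by
  have : {x ∈ μ.cells | x.1 = a ∧ x.2 < k} = {a} ×ˢ Finset.range (min (μ.rowLen a) k) := by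
    ext ⟨i, j⟩
    simp only [Finset.mem_filter, YoungDiagram.mem_cells, YoungDiagram.mem_iff_lt_rowLen,
      Finset.mem_product, Finset.mem_singleton, Finset.mem_range, lt_min_iff]
    constructor
    · rintro ⟨h, rfl, h'⟩
      exact ⟨rfl, h, h'⟩
    · rintro ⟨rfl, h, h'⟩
      exact ⟨h, rfl, h'⟩
  rw [rowColCount, this]
  simp

theorem card_filter_rowOf {N : ℕ} {μ : YoungDiagram} (t : Tableau N μ) (p : ℕ × ℕ → Prop)
    [DecidablePred p] :
    (Finset.univ.filter fun i => p (rowOf t i, colOf t i)).card = (μ.cells.filter p).card := by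
  refine Finset.card_bij (fun i _ => (t i).1) ?_ ?_ ?_
  · intro i hi
    exact Finset.mem_filter.2 ⟨(t i).2, (Finset.mem_filter.1 hi).2⟩
  · intro i _ j _ h
    exact t.injective (Subtype.ext h)
  · intro x hx
    obtain ⟨hx, hp⟩ := Finset.mem_filter.1 hx
    refine ⟨t.symm ⟨x, hx⟩, ?_, by simp⟩
    simpa [rowOf, colOf] using hp

/-- Think of `c` as the column function of a second filling, with no two numbers sharing both a row
of `t` and a value of `c`. Row `a` then contributes at most its length, and at most one number per
value below `k`. -/
theorem card_row_col_le {N : ℕ} {μ : YoungDiagram} (t : Tableau N μ) {c : Fin N → ℕ}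
    (hc : ∀ i j, rowOf t i = rowOf t j → c i = c j → i = j) (a k : ℕ) :
    (Finset.univ.filter fun i => rowOf t i = a ∧ c i < k).card ≤ rowColCount μ a k := by
  rw [rowColCount_eq, le_min_iff]
  constructor
  · have h : (Finset.univ.filter fun i => rowOf t i = a).card = μ.rowLen a := by
      rw [card_filter_rowOf t (fun x => x.1 = a), YoungDiagram.rowLen_eq_card]
      rfl
    rw [← h]
    exact Finset.card_le_card fun i hi => by simp_all
  · rw [← Finset.card_range k]
    refine Finset.card_le_card_of_injOn c (fun i hi => ?_) (fun i hi j hj h => ?_)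
    · simp_all
    · simp only [Finset.coe_filter, Set.mem_ofPred_eq] at hi hj
      exact hc i j (hi.2.1.trans hj.2.1.symm) h

theorem rowOf_lt {N : ℕ} {μ : YoungDiagram} (t : Tableau N μ) (i : Fin N) :
    rowOf t i < μ.colLen 0 := by
  have h : (rowOf t i, colOf t i) ∈ μ := (YoungDiagram.mem_cells _).1 (t i).2
  exact YoungDiagram.mem_iff_lt_colLen.1 (μ.up_left_mem le_rfl (Nat.zero_le _) h)

theorem card_col_eq_sum {N : ℕ} {μ : YoungDiagram} (t : Tableau N μ) (c : Fin N → ℕ) (k : ℕ) :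
    (Finset.univ.filter fun i => c i < k).card =
      ∑ a ∈ Finset.range (μ.colLen 0),
        (Finset.univ.filter fun i => rowOf t i = a ∧ c i < k).card := by
  rw [Finset.card_eq_sum_card_fiberwise (f := rowOf t) (t := Finset.range (μ.colLen 0))
    (fun i _ => by simpa using rowOf_lt t i)]
  refine Finset.sum_congr rfl fun a _ => ?_
  rw [Finset.filter_filter]
  simp only [and_comm]

theorem colCount_eq_sum {N : ℕ} {μ : YoungDiagram} (t : Tableau N μ) (k : ℕ) :
    colCount μ k = ∑ a ∈ Finset.range (μ.colLen 0), rowColCount μ a k := by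
  rw [colCount, ← card_filter_rowOf t (fun x => x.2 < k), card_col_eq_sum t]
  refine Finset.sum_congr rfl fun a _ => ?_
  rw [rowColCount, ← card_filter_rowOf t (fun x => x.1 = a ∧ x.2 < k)]

theorem card_col_le {N : ℕ} {μ : YoungDiagram} (t : Tableau N μ) {c : Fin N → ℕ}
    (hc : ∀ i j, rowOf t i = rowOf t j → c i = c j → i = j) (k : ℕ) :
    (Finset.univ.filter fun i => c i < k).card ≤ colCount μ k := by
  rw [card_col_eq_sum t, colCount_eq_sum t]
  exact Finset.sum_le_sum fun a _ => card_row_col_le t hc a k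

/-- This is the equality case of `card_col_le`: equal totals force equality in each row. -/
theorem mem_of_card_col_eq {N : ℕ} {μ : YoungDiagram} (t : Tableau N μ) {c : Fin N → ℕ}
    (hc : ∀ i j, rowOf t i = rowOf t j → c i = c j → i = j)
    (h : ∀ k, (Finset.univ.filter fun i => c i < k).card = colCount μ k) (i : Fin N) :
    (rowOf t i, c i) ∈ μ := by
  -- Taking `k` to be the length of the row of `i` makes equality say that every number of that row
  -- has `c` below the row length.
  have h1 := h (μ.rowLen (rowOf t i))
  rw [card_col_eq_sum t, colCount_eq_sum t] at h1
  have h2 := (Finset.sum_eq_sum_iff_of_le fun a _ => card_row_col_le t hc a _).1 h1 (rowOf t i)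
    (Finset.mem_range.2 (rowOf_lt t i))
  rw [rowColCount_eq, min_self] at h2
  have h3 : (Finset.univ.filter fun j => rowOf t j = rowOf t i).card = μ.rowLen (rowOf t i) := by
    rw [card_filter_rowOf t (fun x => x.1 = rowOf t i), YoungDiagram.rowLen_eq_card]
    rfl
  have h4 := Finset.eq_of_subset_of_card_le
    (s := Finset.univ.filter fun j => rowOf t j = rowOf t i ∧ c j < μ.rowLen (rowOf t i))
    (t := Finset.univ.filter fun j => rowOf t j = rowOf t i)
    (fun j hj => by simp_all) (by rw [h2, h3])
  have h5 : i ∈ Finset.univ.filter fun j => rowOf t j = rowOf t i := by simp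
  rw [← h4] at h5
  rw [YoungDiagram.mem_iff_lt_rowLen]
  exact (Finset.mem_filter.1 h5).2.2

theorem eq_of_colCount_eq {μ ν : YoungDiagram} (h : ∀ k, colCount μ k = colCount ν k) : μ = ν := by
  have key : ∀ (μ : YoungDiagram) k, colCount μ (k + 1) = colCount μ k + μ.colLen k := by
    intro μ k
    rw [colCount, colCount, YoungDiagram.colLen_eq_card, YoungDiagram.col,
      ← Finset.card_union_of_disjoint]
    · congr 1
      ext x
      simp only [Finset.mem_filter, Finset.mem_union, Nat.lt_succ_iff_lt_or_eq]
      tauto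
    · rw [Finset.disjoint_filter]
      intro x _ h h'
      exact h.ne h'
  have h1 : ∀ k, μ.colLen k = ν.colLen k := by
    intro k
    have := h (k + 1)
    rw [key, key, h k] at this
    omega
  ext ⟨i, j⟩
  rw [YoungDiagram.mem_cells, YoungDiagram.mem_cells, YoungDiagram.mem_iff_lt_colLen,
    YoungDiagram.mem_iff_lt_colLen, h1]

/-! ### Nonvanishing products of row sums and column sums -/

theorem card_colOf_comp {N : ℕ} {μ : YoungDiagram} (t : Tableau N μ) (g : Equiv.Perm (Fin N))
    (k : ℕ) : (Finset.univ.filter fun i => colOf t (g i) < k).card = colCount μ k := by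
  rw [colCount, ← card_filter_rowOf t (fun x => x.2 < k)]
  refine Finset.card_bij (fun i _ => g i) ?_ ?_ ?_
  · simp
  · simp
  · intro i hi
    exact ⟨g⁻¹ i, by simpa using hi, by simp⟩

theorem row_col_injective_of_ne_zero {N : ℕ} {κ κ' : Fin N → ℕ} {g : Equiv.Perm (Fin N)}
    (h : fiberSum κ * MonoidAlgebra.single g 1 * signedFiberSum κ' ≠ 0) (i j : Fin N)
    (hij : κ i = κ j) (hij' : κ' (g⁻¹ i) = κ' (g⁻¹ j)) : i = j := by
  by_contra hne
  refine h ?_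
  rw [mul_assoc, single_mul_signedFiberSum_comm, ← mul_assoc,
    fiberSum_mul_signedFiberSum_eq_zero hne hij hij', zero_mul]

theorem exists_single_mul_ne_zero {N : ℕ} {a b x : SymAlgebra N} (h : a * x * b ≠ 0) :
    ∃ g, a * MonoidAlgebra.single g 1 * b ≠ 0 := by
  by_contra! hg
  refine h ?_
  induction x using MonoidAlgebra.induction_on with
  | of g => exact hg g
  | add x y hx hy =>
    rw [mul_add, add_mul]
    by_cases hx' : a * x * b = 0 <;> by_cases hy' : a * y * b = 0 <;> simp_all
  | smul r x hx =>
    rw [mul_smul_comm, smul_mul_assoc]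
    by_cases hx' : a * x * b = 0 <;> simp_all

/-- Some single permutation `g` in place of `x` survives, and then the filling `u`, relabelled by
`g`, satisfies the injectivity condition of `card_col_le`. This is the dominance order on shapes. -/
theorem colCount_le_of_ne_zero {N : ℕ} {μ ν : YoungDiagram} (t : Tableau N μ) (u : Tableau N ν)
    {x : SymAlgebra N} (h : fiberSum (rowOf t) * x * signedFiberSum (colOf u) ≠ 0) (k : ℕ) :
    colCount ν k ≤ colCount μ k := by
  obtain ⟨g, hg⟩ := exists_single_mul_ne_zero h
  rw [← card_colOf_comp u g⁻¹]
  exact card_col_le t (row_col_injective_of_ne_zero hg) k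

/-- For tableaux of different shapes, one of the two products of a row sum and a signed column sum
vanishes identically. -/
theorem eq_of_fiberSum_mul_ne_zero {N : ℕ} {μ ν : YoungDiagram} (t : Tableau N μ) (u : Tableau N ν)
    {x y : SymAlgebra N} (h : fiberSum (rowOf t) * x * signedFiberSum (colOf u) ≠ 0)
    (h' : fiberSum (rowOf u) * y * signedFiberSum (colOf t) ≠ 0) : μ = ν :=
  eq_of_colCount_eq fun k =>
    le_antisymm (colCount_le_of_ne_zero u t h' k) (colCount_le_of_ne_zero t u h k)

/-- Von Neumann's lemma: if the product is nonzero, `g` factors as a row permutation of `t` times a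
column permutation of `t`, which are absorbed on the left and, up to sign, on the right. -/
theorem exists_fiberSum_mul_single_mul {N : ℕ} {μ : YoungDiagram} (t : Tableau N μ)
    (g : Equiv.Perm (Fin N)) :
    ∃ c : ℂ, fiberSum (rowOf t) * MonoidAlgebra.single g 1 * signedFiberSum (colOf t) =
      c • youngSymmetrizer t := by
  by_cases h : fiberSum (rowOf t) * MonoidAlgebra.single g 1 * signedFiberSum (colOf t) = 0
  · exact ⟨0, by rw [h, zero_smul]⟩
  have hinj := row_col_injective_of_ne_zero h
  have hmem := mem_of_card_col_eq t hinj (card_colOf_comp t g⁻¹)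
  -- `s` moves each `i` within its row of `t` to the column of `g⁻¹ i`; by `hmem` these are boxes of
  -- `μ`. Read through `t`, it is a row permutation `p` for which `p * g` preserves columns.
  let s : Fin N → {x // x ∈ μ.cells} := fun i => ⟨(rowOf t i, colOf t (g⁻¹ i)),
    (YoungDiagram.mem_cells _).2 (hmem i)⟩
  have hs : Function.Injective s := by
    intro i j hij
    have : (rowOf t i, colOf t (g⁻¹ i)) = (rowOf t j, colOf t (g⁻¹ j)) := congrArg Subtype.val hij
    exact hinj i j (Prod.ext_iff.1 this).1 (Prod.ext_iff.1 this).2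
  have hs' : Function.Bijective s :=
    (Fintype.bijective_iff_injective_and_card s).2 ⟨hs, Fintype.card_congr t⟩
  let p : Equiv.Perm (Fin N) := (Equiv.ofBijective s hs').trans t.symm
  have hp : ∀ i, t (p i) = s i := fun i => by simp [p]
  have h1 : p⁻¹ ∈ fiberPerms (rowOf t) := by
    refine inv_mem_fiberPerms (mem_fiberPerms.2 fun i => ?_)
    rw [rowOf, hp]
  have h2 : p * g ∈ fiberPerms (colOf t) := by
    refine mem_fiberPerms.2 fun i => ?_
    rw [colOf, Equiv.Perm.mul_apply, hp]
    simp [s]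
  refine ⟨((Equiv.Perm.sign (p * g) : ℤ) : ℂ), ?_⟩
  have h3 : (MonoidAlgebra.single g 1 : SymAlgebra N) =
      MonoidAlgebra.single p⁻¹ 1 * MonoidAlgebra.single (p * g) 1 := by
    rw [MonoidAlgebra.single_mul_single, mul_one, inv_mul_cancel_left]
  rw [h3, ← mul_assoc, fiberSum_mul_single h1, mul_assoc, single_mul_signedFiberSum h2,
    mul_smul_comm, youngSymmetrizer_eq]

theorem exists_fiberSum_mul_mul {N : ℕ} {μ : YoungDiagram} (t : Tableau N μ) (x : SymAlgebra N) :
    ∃ c : ℂ, fiberSum (rowOf t) * x * signedFiberSum (colOf t) = c • youngSymmetrizer t := by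
  induction x using MonoidAlgebra.induction_on with
  | of g => exact exists_fiberSum_mul_single_mul t g
  | add x y hx hy =>
    obtain ⟨c, hc⟩ := hx
    obtain ⟨d, hd⟩ := hy
    exact ⟨c + d, by rw [mul_add, add_mul, hc, hd, add_smul]⟩
  | smul r x hx =>
    obtain ⟨c, hc⟩ := hx
    exact ⟨r * c, by rw [mul_smul_comm, smul_mul_assoc, hc, mul_smul]⟩

theorem youngSymmetrizer_mul_mul {N : ℕ} {μ : YoungDiagram} (t : Tableau N μ) (x : SymAlgebra N) :
    ∃ c : ℂ, youngSymmetrizer t * x * youngSymmetrizer t = c • youngSymmetrizer t := by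
  obtain ⟨c, hc⟩ := exists_fiberSum_mul_mul t
    (signedFiberSum (colOf t) * x * fiberSum (rowOf t))
  refine ⟨c, ?_⟩
  rw [← hc, youngSymmetrizer_eq]
  simp only [mul_assoc]

/-- Only the identity preserves both rows and columns, so `p * q = 1` has the single solution `p = q
= 1`. -/
theorem youngSymmetrizer_apply_one {N : ℕ} {μ : YoungDiagram} (t : Tableau N μ) :
    (youngSymmetrizer t).coeff 1 = 1 := by
  have key : ∀ p ∈ fiberPerms (rowOf t), ∀ q ∈ fiberPerms (colOf t), p * q = 1 → p = 1 := by
    intro p hp q hq h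
    have hp' : p ∈ fiberPerms (colOf t) := by
      rw [eq_inv_of_mul_eq_one_left h]
      exact inv_mem_fiberPerms hq
    rw [mem_fiberPerms] at hp hp'
    ext1 i
    exact t.injective (Subtype.ext (Prod.ext (hp i) (hp' i)))
  have one_mem : ∀ κ : Fin N → ℕ, (1 : Equiv.Perm (Fin N)) ∈ fiberPerms κ := fun κ => by
    simp [mem_fiberPerms]
  rw [youngSymmetrizer_eq, fiberSum, signedFiberSum, Finset.sum_mul_sum, MonoidAlgebra.coeff_sum,
    Finsupp.finsetSum_apply, Finset.sum_eq_single_of_mem 1 (one_mem _), MonoidAlgebra.coeff_sum,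
    Finsupp.finsetSum_apply, Finset.sum_eq_single_of_mem 1 (one_mem _)]
  · simp [MonoidAlgebra.single_mul_single]
  · intro q _ hq
    rw [MonoidAlgebra.single_mul_single, MonoidAlgebra.coeff_single, Finsupp.single_apply,
      if_neg (by simpa using hq)]
  · intro p hp hp1
    rw [MonoidAlgebra.coeff_sum, Finsupp.finsetSum_apply]
    refine Finset.sum_eq_zero fun q hq => ?_
    rw [MonoidAlgebra.single_mul_single, MonoidAlgebra.coeff_single, Finsupp.single_apply,
      if_neg fun h => hp1 (key p hp q hq h)]

theorem youngSymmetrizer_ne_zero {N : ℕ} {μ : YoungDiagram} (t : Tableau N μ) :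
    youngSymmetrizer t ≠ 0 := by
  intro h
  have := youngSymmetrizer_apply_one t
  simp [h] at this

/-! ### Specht modules -/

/-- The left ideal generated by `e` has an idempotent generator `f = x * e`. If `e * x * e = 0`,
then `f = f * f = 0`, hence `e = 0`. This makes the explicit value of the square of a Young
symmetrizer unnecessary. -/
theorem exists_mul_mul_ne_zero {R : Type*} [Ring R] [IsSemisimpleRing R] {e : R} (he : e ≠ 0) :
    ∃ x, e * x * e ≠ 0 := by
  obtain ⟨f, hf, h⟩ := IsSemisimpleRing.ideal_eq_span_idempotent (Ideal.span {e})
  have hfe : f ∈ Ideal.span {e} := h ▸ Ideal.mem_span_singleton_self f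
  obtain ⟨x, rfl⟩ := Ideal.mem_span_singleton'.1 hfe
  refine ⟨x, fun h0 => he ?_⟩
  have h1 : x * e = 0 := by
    rw [← hf.eq, mul_assoc, ← mul_assoc e, h0, mul_zero]
  rw [h1, Ideal.span_singleton_zero, Ideal.span_singleton_eq_bot] at h
  exact h

/-- The tableau of shape `μ` that defines the Specht module. -/
abbrev stdTableau {N : ℕ} (μ : YoungDiagram) (h : μ.card = N) : Tableau N μ :=
  (μ.cells.equivFinOfCardEq h).symm

theorem mem_spechtModule {N : ℕ} {μ : YoungDiagram} {h : μ.card = N} {x : SymAlgebra N} :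
    x ∈ spechtModule μ h ↔ ∃ y, y * youngSymmetrizer (stdTableau μ h) = x :=
  Submodule.mem_span_singleton

/-- Every `e * x * e` is a scalar multiple of `e`. A nonzero `w * e` in a submodule has some `w * e
* x * w * e ≠ 0`, so multiplying it by `e * x` gives a nonzero multiple of `e`, the generator. -/
instance isSimpleModule_spechtModule {N : ℕ} (μ : YoungDiagram) (h : μ.card = N) :
    IsSimpleModule (SymAlgebra N) (spechtModule μ h) := by
  set e := youngSymmetrizer (stdTableau μ h) with he
  have he0 : e ≠ 0 := youngSymmetrizer_ne_zero _
  rw [isSimpleModule_iff_isAtom]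
  have he1 : e ∈ spechtModule μ h := mem_spechtModule.2 ⟨1, one_mul _⟩
  refine ⟨fun h0 => he0 (by rwa [h0, Submodule.mem_bot] at he1), fun W hW => ?_⟩
  by_contra hne
  obtain ⟨y, hy, hy0⟩ := Submodule.exists_mem_ne_zero_of_ne_bot hne
  obtain ⟨x, hx⟩ := exists_mul_mul_ne_zero hy0
  obtain ⟨w, rfl⟩ := mem_spechtModule.1 (hW.le hy)
  rw [mul_assoc, mul_assoc] at hx
  have hxy : x * (w * e) ∈ W := W.smul_mem x hy
  obtain ⟨c, hc⟩ := youngSymmetrizer_mul_mul (stdTableau μ h) (x * w)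
  have hc' : e * (x * (w * e)) = c • e := by rw [← hc]; simp only [mul_assoc, he]
  have hc0 : c ≠ 0 := by
    rintro rfl
    exact hx (by rw [hc', zero_smul, mul_zero])
  have heW : e ∈ W := by
    have h1 := W.smul_mem (algebraMap ℂ _ c⁻¹ * e) hxy
    rwa [smul_eq_mul, mul_assoc, hc', ← Algebra.smul_def, smul_smul, inv_mul_cancel₀ hc0,
      one_smul] at h1
  exact hW.not_ge (by rwa [spechtModule, Submodule.span_singleton_le_iff_mem])

/-- Schur's lemma for the map `x ↦ x • v` from the Specht module to `V`, which is nonzero on the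
Young symmetrizer. -/
theorem nonempty_linearEquiv_spechtModule {N : ℕ} {V : Type*} [AddCommGroup V]
    [Module (SymAlgebra N) V] [IsSimpleModule (SymAlgebra N) V] {μ : YoungDiagram}
    {h : μ.card = N} {v : V} (hv : youngSymmetrizer (stdTableau μ h) • v ≠ 0) :
    Nonempty (V ≃ₗ[SymAlgebra N] spechtModule μ h) := by
  let f := (LinearMap.toSpanSingleton (SymAlgebra N) V v).domRestrict (spechtModule μ h)
  rcases f.bijective_or_eq_zero with hf | hf
  · exact ⟨(LinearEquiv.ofBijective f hf).symm⟩
  · refine absurd ?_ hv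
    exact LinearMap.congr_fun hf ⟨_, mem_spechtModule.2 ⟨1, one_mul _⟩⟩

theorem exists_youngSymmetrizer_smul_ne_zero {N : ℕ} {V : Type*} [AddCommGroup V]
    [Module (SymAlgebra N) V] {μ : YoungDiagram} {h : μ.card = N}
    (f : V ≃ₗ[SymAlgebra N] spechtModule μ h) :
    ∃ v : V, youngSymmetrizer (stdTableau μ h) • v ≠ 0 := by
  obtain ⟨x, hx⟩ := exists_mul_mul_ne_zero (youngSymmetrizer_ne_zero (stdTableau μ h))
  refine ⟨f.symm ⟨x * youngSymmetrizer (stdTableau μ h), mem_spechtModule.2 ⟨x, rfl⟩⟩, ?_⟩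
  rw [← map_smul]
  intro h0
  refine hx ?_
  have := congrArg Subtype.val (f.symm.map_eq_zero_iff.1 h0)
  simpa [mul_assoc] using this

theorem eq_of_spechtModule_linearEquiv {N : ℕ} {μ ν : YoungDiagram} {h : μ.card = N}
    {h' : ν.card = N} (f : spechtModule μ h ≃ₗ[SymAlgebra N] spechtModule ν h') : μ = ν := by
  -- The Young symmetrizer of `ν` acts nontrivially on any copy of its own module, so `e_ν * y * e_μ
  -- ≠ 0` for some `y`. Its outer factors are the row sum of `ν` and the column sum of `μ`.
  have key : ∀ {μ ν : YoungDiagram} {h : μ.card = N} {h' : ν.card = N}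
      (_ : spechtModule μ h ≃ₗ[SymAlgebra N] spechtModule ν h'),
      ∃ x, fiberSum (rowOf (stdTableau ν h')) * x * signedFiberSum (colOf (stdTableau μ h)) ≠ 0 := by
    intro μ ν h h' f
    obtain ⟨⟨v, hv⟩, h0⟩ := exists_youngSymmetrizer_smul_ne_zero f
    obtain ⟨y, rfl⟩ := mem_spechtModule.1 hv
    refine ⟨signedFiberSum (colOf (stdTableau ν h')) * y * fiberSum (rowOf (stdTableau μ h)),
      fun h1 => h0 (Subtype.ext ?_)⟩
    simp only [youngSymmetrizer_eq, mul_assoc, SetLike.mk_smul_mk, smul_eq_mul] at h1 ⊢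
    exact h1
  obtain ⟨x, hx⟩ := key f
  obtain ⟨y, hy⟩ := key f.symm
  exact eq_of_fiberSum_mul_ne_zero _ _ hy hx

/-! ### The center of the group algebra -/

/-- The sum of the conjugates of an element of the group algebra. -/
def conjSum {N : ℕ} (x : SymAlgebra N) : SymAlgebra N :=
  ∑ g, MonoidAlgebra.single g 1 * x * MonoidAlgebra.single g⁻¹ 1

theorem single_mul_conjSum {N : ℕ} (x : SymAlgebra N) (g : Equiv.Perm (Fin N)) :
    MonoidAlgebra.single g 1 * conjSum x = conjSum x * MonoidAlgebra.single g 1 := by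
  unfold conjSum
  rw [Finset.mul_sum, Finset.sum_mul]
  refine Fintype.sum_equiv (Equiv.mulLeft g) _ _ fun k => ?_
  simp only [Equiv.coe_mulLeft, mul_assoc, MonoidAlgebra.single_mul_single, mul_one, mul_inv_rev,
    inv_mul_cancel]
  simp only [← mul_assoc, MonoidAlgebra.single_mul_single, mul_one]

theorem mul_comm_of_single_mul {N : ℕ} {z : SymAlgebra N}
    (hz : ∀ g, MonoidAlgebra.single g 1 * z = z * MonoidAlgebra.single g 1) (x : SymAlgebra N) :
    x * z = z * x := by
  induction x using MonoidAlgebra.induction_on with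
  | of g => exact hz g
  | add x y hx hy => rw [add_mul, mul_add, hx, hy]
  | smul r x hx => rw [smul_mul_assoc, mul_smul_comm, hx]

theorem mul_conjSum {N : ℕ} (x y : SymAlgebra N) : y * conjSum x = conjSum x * y :=
  mul_comm_of_single_mul (single_mul_conjSum x) y

theorem conjSum_smul_eq_zero {N : ℕ} {V : Type*} [AddCommGroup V] [Module (SymAlgebra N) V]
    {x : SymAlgebra N} (hx : ∀ v : V, x • v = 0) (v : V) : conjSum x • v = 0 := by
  unfold conjSum
  rw [Finset.sum_smul]
  exact Finset.sum_eq_zero fun g _ => by rw [mul_smul, mul_smul, hx, smul_zero]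

theorem conjSum_apply_one {N : ℕ} (x : SymAlgebra N) :
    (conjSum x).coeff 1 = (Nat.factorial N : ℂ) * x.coeff 1 := by
  unfold conjSum
  rw [MonoidAlgebra.coeff_sum, Finsupp.finsetSum_apply]
  have : ∀ g : Equiv.Perm (Fin N),
      (MonoidAlgebra.single g 1 * x * MonoidAlgebra.single g⁻¹ 1 : SymAlgebra N).coeff 1 =
        x.coeff 1 := by
    intro g
    rw [MonoidAlgebra.coeff_mul_single_apply, MonoidAlgebra.coeff_single_mul_apply]
    simp
  simp [this, Fintype.card_perm]

/-- The central element of the group algebra obtained from the Young symmetrizer of shape `μ`. -/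
def spechtCenter {N : ℕ} (μ : YoungDiagram) (h : μ.card = N) : SymAlgebra N :=
  conjSum (youngSymmetrizer (stdTableau μ h))

theorem spechtCenter_ne_zero {N : ℕ} (μ : YoungDiagram) (h : μ.card = N) :
    spechtCenter μ h ≠ 0 := by
  intro h0
  have h1 := conjSum_apply_one (youngSymmetrizer (stdTableau μ h))
  rw [youngSymmetrizer_apply_one, mul_one, ← spechtCenter, h0] at h1
  exact Nat.cast_ne_zero.2 (Nat.factorial_ne_zero N) h1.symm

/-- A vector not killed by the Young symmetrizer would make `V` a copy of the Specht module. So the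
symmetrizer kills `V`, and so do its conjugates. -/
theorem spechtCenter_smul_eq_zero {N : ℕ} {V : Type*} [AddCommGroup V] [Module (SymAlgebra N) V]
    [IsSimpleModule (SymAlgebra N) V] {μ : YoungDiagram} {h : μ.card = N}
    (hV : IsEmpty (V ≃ₗ[SymAlgebra N] spechtModule μ h)) (v : V) : spechtCenter μ h • v = 0 := by
  refine conjSum_smul_eq_zero (fun v => ?_) v
  by_contra h0
  exact not_isEmpty_iff.2 (nonempty_linearEquiv_spechtModule h0) hV

/-- Otherwise the central element would kill every simple left ideal, hence the whole semisimple
group algebra, hence `1`. But its coefficient at the identity is `N!`. -/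
theorem exists_spechtCenter_smul_ne_zero {N : ℕ} (μ : YoungDiagram) (h : μ.card = N) :
    ∃ v : spechtModule μ h, spechtCenter μ h • v ≠ 0 := by
  by_contra! h0
  refine spechtCenter_ne_zero μ h ?_
  -- The annihilated elements form a left ideal because `spechtCenter` is central.
  let K : Submodule (SymAlgebra N) (SymAlgebra N) :=
    { carrier := {x | spechtCenter μ h * x = 0}
      add_mem' := fun {x y} hx hy => by
        simp only [Set.mem_ofPred_eq] at *
        rw [mul_add, hx, hy, add_zero]
      zero_mem' := mul_zero _
      smul_mem' := fun c x hx => by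
        simp only [Set.mem_ofPred_eq, smul_eq_mul] at *
        rw [← mul_assoc, spechtCenter, ← mul_conjSum, mul_assoc, ← spechtCenter, hx, mul_zero] }
  have hK : K = ⊤ := by
    rw [eq_top_iff, ← IsSemisimpleModule.sSup_simples_eq_top, sSup_le_iff]
    intro W hW w hw
    have : IsSimpleModule (SymAlgebra N) W := hW
    change spechtCenter μ h * w = 0
    by_cases he : Nonempty (W ≃ₗ[SymAlgebra N] spechtModule μ h)
    · obtain ⟨f⟩ := he
      have h1 : spechtCenter μ h • (⟨w, hw⟩ : W) = 0 := by
        apply f.injective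
        rw [map_smul, h0, map_zero]
      exact congrArg Subtype.val h1
    · exact congrArg Subtype.val (spechtCenter_smul_eq_zero (not_nonempty_iff.1 he) ⟨w, hw⟩)
  have h1 : (1 : SymAlgebra N) ∈ K := hK ▸ Submodule.mem_top
  simpa [K] using h1

/-! ### Counting diagrams against conjugacy classes -/

theorem card_eq_sum_rowLens (μ : YoungDiagram) : μ.card = μ.rowLens.sum := by
  rw [YoungDiagram.rowLens, ← Multiset.sum_coe, ← Multiset.map_coe]
  change μ.cells.card = ∑ i ∈ Finset.range (μ.colLen 0), μ.rowLen i
  rw [Finset.card_eq_sum_card_fiberwise (f := Prod.fst) (t := Finset.range (μ.colLen 0))]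
  · refine Finset.sum_congr rfl fun i _ => ?_
    rw [YoungDiagram.rowLen_eq_card]
    rfl
  · rintro ⟨i, j⟩ hx
    simp only [Finset.coe_range, Set.mem_Iio]
    exact YoungDiagram.mem_iff_lt_colLen.1
      (μ.up_left_mem le_rfl (Nat.zero_le _) ((YoungDiagram.mem_cells _).1 hx))

theorem colLen_le_card (μ : YoungDiagram) (j : ℕ) : μ.colLen j ≤ μ.card := by
  rw [YoungDiagram.colLen_eq_card]
  exact Finset.card_le_card (Finset.filter_subset _ _)

/-- The parts in decreasing order are row lengths. The bound of `N` rows is vacuous for `N` boxes.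
-/
theorem card_partition_le (N : ℕ) :
    Fintype.card (Nat.Partition N) ≤ Fintype.card (BoundedDiagram N N) := by
  have hs : ∀ p : Nat.Partition N, (p.parts.sort (· ≥ ·)).SortedGE := fun p =>
    (Multiset.pairwise_sort _ _).sortedGE
  have hr : ∀ p : Nat.Partition N, (YoungDiagram.ofRowLens _ (hs p)).rowLens =
      p.parts.sort (· ≥ ·) := fun p =>
    YoungDiagram.rowLens_ofRowLens_eq_self fun x hx => p.parts_pos (by simpa using hx)
  have hc : ∀ p : Nat.Partition N, (YoungDiagram.ofRowLens _ (hs p)).card = N := fun p => by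
    rw [card_eq_sum_rowLens, hr, ← Multiset.sum_coe, Multiset.sort_eq, p.parts_sum]
  refine Fintype.card_le_of_injective (fun p => (⟨YoungDiagram.ofRowLens _ (hs p), hc p,
    (colLen_le_card _ _).trans (hc p).le⟩ : BoundedDiagram N N)) fun p q hpq => ?_
  have h1 := congrArg (fun μ : BoundedDiagram N N => μ.1.rowLens) hpq
  simp only [hr] at h1
  ext1
  rw [← Multiset.sort_eq p.parts (· ≥ ·), h1, Multiset.sort_eq]

/-- On the Specht module of `ν` all these elements act as zero except the one of `ν` itself. -/
theorem linearIndependent_spechtCenter (N : ℕ) :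
    LinearIndependent ℂ fun μ : BoundedDiagram N N => spechtCenter μ.1 μ.2.1 := by
  rw [Fintype.linearIndependent_iff]
  intro c hc ν
  by_contra h0
  obtain ⟨v, hv⟩ := exists_spechtCenter_smul_ne_zero ν.1 ν.2.1
  have h1 : ∀ μ : BoundedDiagram N N, μ ≠ ν → spechtCenter μ.1 μ.2.1 * v.1 = 0 := by
    intro μ hμ
    have h2 : spechtCenter μ.1 μ.2.1 • v = 0 := spechtCenter_smul_eq_zero
      ⟨fun f => hμ (Subtype.ext (eq_of_spechtModule_linearEquiv f).symm)⟩ v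
    exact congrArg Subtype.val h2
  have h2 := congrArg (· * v.1) hc
  simp only [Finset.sum_mul, zero_mul, smul_mul_assoc] at h2
  rw [Finset.sum_eq_single ν (fun μ _ hμ => by rw [h1 μ hμ, smul_zero]) (by simp)] at h2
  exact hv (Subtype.ext ((smul_eq_zero.1 h2).resolve_left h0))

/-- The element of the group algebra with the coefficients of a class function. -/
def ofClassFunction (N : ℕ) : (Nat.Partition (Fintype.card (Fin N)) → ℂ) →ₗ[ℂ] SymAlgebra N where
  toFun F := ∑ g : Equiv.Perm (Fin N), MonoidAlgebra.single g (F g.partition)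
  map_add' F G := by
    simp only [Pi.add_apply, MonoidAlgebra.single_add, Finset.sum_add_distrib]
  map_smul' c F := by
    simp only [Pi.smul_apply, RingHom.id_apply, Finset.smul_sum, MonoidAlgebra.smul_single]

theorem mem_range_ofClassFunction {N : ℕ} {z : SymAlgebra N}
    (hz : ∀ g, MonoidAlgebra.single g 1 * z = z * MonoidAlgebra.single g 1) :
    z ∈ LinearMap.range (ofClassFunction N) := by
  classical
  have h1 : ∀ g h : Equiv.Perm (Fin N), z.coeff (g * h * g⁻¹) = z.coeff h := by
    intro g h
    have := congrArg (fun x : SymAlgebra N => x.coeff (g * h)) (hz g)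
    simp only [MonoidAlgebra.coeff_mul_single_apply, MonoidAlgebra.coeff_single_mul_apply] at this
    simpa using this.symm
  have h2 : ∀ g h : Equiv.Perm (Fin N), g.partition = h.partition → z.coeff g = z.coeff h := by
    intro g h hgh
    obtain ⟨k, rfl⟩ := isConj_iff.1 (Equiv.Perm.partition_eq_of_isConj.2 hgh)
    exact (h1 k g).symm
  -- The value at a cycle type is read off any permutation of that type; the default 0 is never
  -- read, since `ofClassFunction` evaluates only at cycle types.
  refine ⟨fun p => if hp : ∃ g : Equiv.Perm (Fin N), g.partition = p then z.coeff hp.choose else 0,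
    ?_⟩
  ext g
  simp only [ofClassFunction, LinearMap.coe_mk, AddHom.coe_mk, MonoidAlgebra.coeff_sum,
    Finsupp.finsetSum_apply, MonoidAlgebra.coeff_single, Finsupp.single_apply]
  rw [Finset.sum_ite_eq' Finset.univ g, if_pos (Finset.mem_univ _)]
  have hp : ∃ k : Equiv.Perm (Fin N), k.partition = g.partition := ⟨g, rfl⟩
  rw [dif_pos hp]
  exact h2 _ _ hp.choose_spec

/-- Dimension count: the independent family lies in the space of class functions, whose dimension is
at most the number of partitions of `N`, hence at most the size of the family. So it spans that
space, which contains `1`. -/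
theorem one_mem_span_spechtCenter (N : ℕ) : (1 : SymAlgebra N) ∈
    Submodule.span ℂ (Set.range fun μ : BoundedDiagram N N => spechtCenter μ.1 μ.2.1) := by
  have h1 : Submodule.span ℂ (Set.range fun μ : BoundedDiagram N N => spechtCenter μ.1 μ.2.1) =
      LinearMap.range (ofClassFunction N) := by
    apply Submodule.eq_of_le_of_finrank_le
    · rw [Submodule.span_le]
      rintro _ ⟨μ, rfl⟩
      exact mem_range_ofClassFunction (single_mul_conjSum _)
    · rw [finrank_span_eq_card (linearIndependent_spechtCenter N)]
      refine (LinearMap.finrank_range_le _).trans ?_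
      rw [Module.finrank_pi, Fintype.card_fin]
      exact card_partition_le N
  rw [h1]
  exact mem_range_ofClassFunction fun g => by rw [mul_one, one_mul]

/-- Every irreducible representation of the symmetric group is a Specht module. -/
theorem exists_linearEquiv_spechtModule {N : ℕ} (V : Type*) [AddCommGroup V]
    [Module (SymAlgebra N) V] [IsSimpleModule (SymAlgebra N) V] :
    ∃ (μ : YoungDiagram) (h : μ.card = N), Nonempty (V ≃ₗ[SymAlgebra N] spechtModule μ h) := by
  by_contra! h0
  have h1 : ∀ x ∈ Submodule.span ℂ
      -- A simple module unlike all Specht modules would be killed by every `spechtCenter`, hence by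
      -- `1`.
      (Set.range fun μ : BoundedDiagram N N => spechtCenter μ.1 μ.2.1), ∀ v : V, x • v = 0 := by
    intro x hx
    induction hx using Submodule.span_induction with
    | mem x hx =>
      obtain ⟨μ, rfl⟩ := hx
      exact spechtCenter_smul_eq_zero (h0 μ.1 μ.2.1)
    | zero => simp
    | add x y _ _ hx hy => intro v; rw [add_smul, hx, hy, add_zero]
    | smul c x _ hx => intro v; rw [Algebra.smul_def, mul_smul, hx, smul_zero]
  have := IsSimpleModule.nontrivial (SymAlgebra N) V
  obtain ⟨v, hv⟩ := exists_ne (0 : V)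
  exact hv (by simpa using h1 1 (one_mem_span_spechtCenter N) v)

/-! ### The Schur-Weyl decomposition -/

/-- By Schur's lemma over `ℂ`, a central `z` acts on `S` as a scalar, and then as the same scalar on
every copy of `S` in `M`. Keeping the statement about `S` itself lets the scalar be computed there.
-/
theorem exists_smul_eq_of_mem_isotypicComponent {R M S : Type*} [Ring R] [Algebra ℂ R]
    [AddCommGroup M] [Module R M] [AddCommGroup S] [Module R S] [Module ℂ S]
    [IsScalarTower ℂ R S] [FiniteDimensional ℂ S] [IsSimpleModule R S] {z : R}
    (hz : ∀ x, x * z = z * x) :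
    ∃ ζ : ℂ, (∀ s : S, z • s = ζ • s) ∧
      ∀ v ∈ isotypicComponent R M S, z • v = algebraMap ℂ R ζ • v := by
  have hcomm : ∀ (x : R) (s : S), z • x • s = x • z • s := fun x s => by
    rw [← mul_smul, ← hz, mul_smul]
  let f : Module.End R S :=
    { toFun := fun s => z • s
      map_add' := smul_add z
      map_smul' := fun x s => hcomm x s }
  obtain ⟨ζ, hζ⟩ := (IsSimpleModule.algebraMap_end_bijective_of_isAlgClosed (A := R) (V := S) ℂ).2 f
  have h1 : ∀ s : S, z • s = ζ • s := fun s => (LinearMap.congr_fun hζ s).symm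
  refine ⟨ζ, h1, fun v hv => ?_⟩
  let K : Submodule R M :=
    { carrier := {v | z • v = algebraMap ℂ R ζ • v}
      add_mem' := fun {x y} hx hy => by
        simp only [Set.mem_ofPred_eq] at *
        rw [smul_add, smul_add, hx, hy]
      zero_mem' := by simp
      smul_mem' := fun c x hx => by
        simp only [Set.mem_ofPred_eq] at *
        rw [← mul_smul, ← hz, mul_smul, hx, ← mul_smul, ← mul_smul, Algebra.commutes] }
  suffices h : isotypicComponent R M S ≤ K from h hv
  refine sSup_le fun W hW w hw => ?_
  obtain ⟨e⟩ := hW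
  change z • w = algebraMap ℂ R ζ • w
  have h2 : z • (⟨w, hw⟩ : W) = algebraMap ℂ R ζ • (⟨w, hw⟩ : W) := by
    apply e.injective
    rw [map_smul, map_smul, h1, algebraMap_smul]
  exact congrArg Subtype.val h2

theorem permRep_apply {N d : ℕ} (g : Equiv.Perm (Fin N)) (v : EuclideanSpace ℂ (Fin N → Fin d))
    (x : Fin N → Fin d) : permRep N d g v x = v (x ∘ g) := rfl

theorem inner_permRep {N d : ℕ} (g : Equiv.Perm (Fin N))
    (u v : EuclideanSpace ℂ (Fin N → Fin d)) :
    inner ℂ (permRep N d g u) v = inner ℂ u (permRep N d g⁻¹ v) := by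
  rw [PiLp.inner_apply, PiLp.inner_apply]
  refine Fintype.sum_equiv (Equiv.arrowCongr g.symm (Equiv.refl _)) _ _ fun x => ?_
  have hx : Equiv.arrowCongr g.symm (Equiv.refl _) x = x ∘ g := rfl
  have hx' : (x ∘ g) ∘ ⇑g⁻¹ = x := by
    funext i
    simp
  rw [permRep_apply, permRep_apply, hx, hx']

theorem mem_schurWeylSummand {N d : ℕ} {μ : BoundedDiagram N d}
    {v : EuclideanSpace ℂ (Fin N → Fin d)} :
    v ∈ schurWeylSummand μ ↔ (permRep N d).asModuleEquiv.symm v ∈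
      isotypicComponent (SymAlgebra N) (permRep N d).asModule (spechtModule μ.1 μ.2.1) := by
  constructor
  · rintro ⟨w, hw, rfl⟩
    exact hw
  · intro h
    exact ⟨_, h, rfl⟩

theorem asModuleEquiv_symm_smul {N d : ℕ} (z : SymAlgebra N)
    (v : EuclideanSpace ℂ (Fin N → Fin d)) :
    (permRep N d).asModuleEquiv.symm ((permRep N d).asAlgebraHom z v) =
      z • (permRep N d).asModuleEquiv.symm v := rfl

theorem exists_asAlgebraHom_eq_smul {N d : ℕ} {z : SymAlgebra N} (hz : ∀ x, x * z = z * x)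
    (μ : BoundedDiagram N d) : ∃ ζ : ℂ, (∀ s : spechtModule μ.1 μ.2.1, z • s = ζ • s) ∧
      ∀ v ∈ schurWeylSummand μ, (permRep N d).asAlgebraHom z v = ζ • v := by
  have : FiniteDimensional ℂ (spechtModule μ.1 μ.2.1) :=
    inferInstanceAs (FiniteDimensional ℂ ((spechtModule μ.1 μ.2.1).restrictScalars ℂ))
  obtain ⟨ζ, h1, h2⟩ := exists_smul_eq_of_mem_isotypicComponent (M := (permRep N d).asModule)
    (S := spechtModule μ.1 μ.2.1) hz
  refine ⟨ζ, h1, fun v hv => ?_⟩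
  apply (permRep N d).asModuleEquiv.symm.injective
  rw [asModuleEquiv_symm_smul, h2 _ (mem_schurWeylSummand.1 hv), algebraMap_smul, map_smul]

theorem asAlgebraHom_mem_schurWeylSummand {N d : ℕ} {μ : BoundedDiagram N d}
    {v : EuclideanSpace ℂ (Fin N → Fin d)} (hv : v ∈ schurWeylSummand μ) (z : SymAlgebra N) :
    (permRep N d).asAlgebraHom z v ∈ schurWeylSummand μ :=
  mem_schurWeylSummand.2 (Submodule.smul_mem _ z (mem_schurWeylSummand.1 hv))

theorem permRep_mem_schurWeylSummand {N d : ℕ} {μ : BoundedDiagram N d}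
    {v : EuclideanSpace ℂ (Fin N → Fin d)} (hv : v ∈ schurWeylSummand μ)
    (g : Equiv.Perm (Fin N)) : permRep N d g v ∈ schurWeylSummand μ := by
  have := asAlgebraHom_mem_schurWeylSummand hv (MonoidAlgebra.single g 1)
  rwa [Representation.asAlgebraHom_single, one_smul] at this

theorem spechtCenter_apply_ne {N d : ℕ} {μ ν : BoundedDiagram N d} (hμν : ν ≠ μ)
    {v : EuclideanSpace ℂ (Fin N → Fin d)} (hv : v ∈ schurWeylSummand ν) :
    (permRep N d).asAlgebraHom (spechtCenter μ.1 μ.2.1) v = 0 := by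
  obtain ⟨ζ, h1, h2⟩ := exists_asAlgebraHom_eq_smul (mul_conjSum _) ν
  rw [spechtCenter, h2 v hv]
  suffices ζ = 0 by rw [this, zero_smul]
  have := IsSimpleModule.nontrivial (SymAlgebra N) (spechtModule ν.1 ν.2.1)
  obtain ⟨s, hs⟩ := exists_ne (0 : spechtModule ν.1 ν.2.1)
  refine (smul_eq_zero.1 ((h1 s).symm.trans (spechtCenter_smul_eq_zero ⟨fun f => hμν ?_⟩ s)))
    |>.resolve_right hs
  exact Subtype.ext (eq_of_spechtModule_linearEquiv f)

theorem exists_spechtCenter_apply_eq {N d : ℕ} (μ : BoundedDiagram N d) :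
    ∃ ζ : ℂ, ζ ≠ 0 ∧ ∀ v ∈ schurWeylSummand μ,
      (permRep N d).asAlgebraHom (spechtCenter μ.1 μ.2.1) v = ζ • v := by
  obtain ⟨ζ, h1, h2⟩ := exists_asAlgebraHom_eq_smul (mul_conjSum _) μ
  refine ⟨ζ, ?_, h2⟩
  rintro rfl
  obtain ⟨s, hs⟩ := exists_spechtCenter_smul_ne_zero μ.1 μ.2.1
  exact hs ((h1 s).trans (zero_smul _ _))

theorem permRep_comm_asAlgebraHom {N d : ℕ} {z : SymAlgebra N} (hz : ∀ x, x * z = z * x)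
    (g : Equiv.Perm (Fin N)) (v : EuclideanSpace ℂ (Fin N → Fin d)) :
    permRep N d g ((permRep N d).asAlgebraHom z v) =
      (permRep N d).asAlgebraHom z (permRep N d g v) := by
  have h := congrArg (fun y => (permRep N d).asAlgebraHom y v) (hz (MonoidAlgebra.single g 1))
  simpa [map_mul, Representation.asAlgebraHom_single] using h

/-- Isotypic components are stable under every equivariant endomorphism. This will be applied to an
adjoint, which is not given as the action of a group algebra element. -/
theorem map_mem_schurWeylSummand {N d : ℕ} {μ : BoundedDiagram N d}
    (f : EuclideanSpace ℂ (Fin N → Fin d) →ₗ[ℂ] EuclideanSpace ℂ (Fin N → Fin d))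
    (hf : ∀ g v, f (permRep N d g v) = permRep N d g (f v))
    {v : EuclideanSpace ℂ (Fin N → Fin d)} (hv : v ∈ schurWeylSummand μ) :
    f v ∈ schurWeylSummand μ := by
  let F : (permRep N d).asModule →ₗ[SymAlgebra N] (permRep N d).asModule :=
    MonoidAlgebra.equivariantOfLinearOfComm
      ((permRep N d).asModuleEquiv.symm.toLinearMap ∘ₗ f ∘ₗ
        (permRep N d).asModuleEquiv.toLinearMap) fun g v => by
      simp only [LinearMap.comp_apply, LinearEquiv.coe_coe, Representation.asModuleEquiv_map_smul,
        Representation.asAlgebraHom_single, one_smul, hf]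
      rw [← one_smul ℂ (permRep N d g), ← Representation.asAlgebraHom_single,
        asModuleEquiv_symm_smul]
  exact mem_schurWeylSummand.2
    (F.le_comap_isotypicComponent _ (mem_schurWeylSummand.1 hv))

/-- Let `X` be the action of the central element of `μ`: a nonzero scalar `ζ` on the summand of `μ`,
zero on that of `ν`. Its adjoint is equivariant and keeps `w` in the summand of `ν`, so `X (X† w) =
0`, whence `X† w = 0` and `⟪ζ • u, w⟫ = ⟪u, X† w⟫ = 0`. -/
theorem inner_eq_zero_of_mem_schurWeylSummand {N d : ℕ} {μ ν : BoundedDiagram N d} (hμν : μ ≠ ν)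
    {u w : EuclideanSpace ℂ (Fin N → Fin d)} (hu : u ∈ schurWeylSummand μ)
    (hw : w ∈ schurWeylSummand ν) : inner ℂ u w = 0 := by
  obtain ⟨ζ, hζ, h1⟩ := exists_spechtCenter_apply_eq μ
  set X := (permRep N d).asAlgebraHom (spechtCenter μ.1 μ.2.1) with hX
  have h2 : ∀ g v, X.adjoint (permRep N d g v) = permRep N d g (X.adjoint v) := by
    intro g v
    refine ext_inner_left ℂ fun y => ?_
    rw [LinearMap.adjoint_inner_right, ← inv_inv g, ← inner_permRep, ← inner_permRep,
      LinearMap.adjoint_inner_right, hX, spechtCenter,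
      permRep_comm_asAlgebraHom (mul_conjSum _)]
  have h3 := map_mem_schurWeylSummand X.adjoint h2 hw
  have h4 : X.adjoint w = 0 := by
    rw [← inner_self_eq_zero (𝕜 := ℂ), LinearMap.adjoint_inner_right,
      spechtCenter_apply_ne hμν.symm h3, inner_zero_left]
  have h5 : inner ℂ (ζ • u) w = 0 := by
    rw [← h1 u hu, ← LinearMap.adjoint_inner_right, h4, inner_zero_right]
  rw [inner_smul_left] at h5
  exact (mul_eq_zero.1 h5).resolve_left (by simpa using hζ)

/-- A word in `d` letters repeats a letter at two positions in the first column. Their transposition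
fixes the word but changes the sign of the antisymmetrized vector, so that coordinate is zero. -/
theorem signedFiberSum_colOf_apply {N d : ℕ} {μ : YoungDiagram} (t : Tableau N μ)
    (hd : d < μ.colLen 0) (v : EuclideanSpace ℂ (Fin N → Fin d)) :
    (permRep N d).asAlgebraHom (signedFiberSum (colOf t)) v = 0 := by
  ext x
  have h1 : (Finset.univ : Finset (Fin d)).card <
      (Finset.univ.filter fun i => colOf t i = 0).card := by
    rw [card_filter_rowOf t (fun y => y.2 = 0), Finset.card_fin]
    rw [YoungDiagram.colLen_eq_card] at hd
    exact hd
  obtain ⟨i, hi, j, hj, hij, hx⟩ := Finset.exists_ne_map_eq_of_card_lt_of_maps_to h1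
    (f := x) (fun i _ => Finset.mem_univ _)
  have hij' : colOf t i = colOf t j := by
    rw [(Finset.mem_filter.1 hi).2, (Finset.mem_filter.1 hj).2]
  have h2 := congrArg (fun y => (permRep N d).asAlgebraHom y v x)
    (single_mul_signedFiberSum (swap_mem_fiberPerms hij'))
  simp only [map_mul, Module.End.mul_apply, Representation.asAlgebraHom_single, one_smul,
    permRep_apply, Equiv.Perm.sign_swap hij] at h2
  have h3 : x ∘ Equiv.swap i j = x := by
    funext k
    rw [Function.comp_apply, Equiv.swap_apply_def]
    split_ifs <;> simp_all
  rw [h3] at h2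
  simpa [self_eq_neg] using h2

theorem iSup_schurWeylSummand (N d : ℕ) :
    ⨆ μ : BoundedDiagram N d, schurWeylSummand μ = ⊤ := by
  let K : Submodule (SymAlgebra N) (permRep N d).asModule := ⨆ μ : BoundedDiagram N d,
    isotypicComponent (SymAlgebra N) (permRep N d).asModule (spechtModule μ.1 μ.2.1)
  have hK : K = ⊤ := by
    rw [eq_top_iff, ← IsSemisimpleModule.sSup_simples_eq_top, sSup_le_iff]
    intro W hW
    have : IsSimpleModule (SymAlgebra N) W := hW
    obtain ⟨μ, h, ⟨e⟩⟩ := exists_linearEquiv_spechtModule (N := N) W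
    -- With more than `d` rows, the Young symmetrizer would act as zero on the tensor power,
    -- contradicting its nonzero action on a copy of its own module.
    have hd : μ.colLen 0 ≤ d := by
      by_contra hd
      obtain ⟨v, hv⟩ := exists_youngSymmetrizer_smul_ne_zero e
      refine hv (Subtype.ext ?_)
      rw [youngSymmetrizer_eq, mul_smul]
      have := signedFiberSum_colOf_apply (stdTableau μ h) (not_le.1 hd)
        ((permRep N d).asModuleEquiv v.1)
      rw [← Representation.asModuleEquiv_map_smul, LinearEquiv.map_eq_zero_iff] at this
      simp [this]
    have hW' : W ≤ isotypicComponent (SymAlgebra N) (permRep N d).asModule (spechtModule μ h) :=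
      le_sSup ⟨e⟩
    exact hW'.trans (le_iSup (fun μ : BoundedDiagram N d =>
      isotypicComponent (SymAlgebra N) (permRep N d).asModule (spechtModule μ.1 μ.2.1)) ⟨μ, h, hd⟩)
  rw [eq_top_iff]
  intro v _
  have hv : (permRep N d).asModuleEquiv.symm v ∈ K := hK ▸ Submodule.mem_top
  suffices h : ∀ w ∈ K, (permRep N d).asModuleEquiv w ∈
      ⨆ μ : BoundedDiagram N d, schurWeylSummand μ from h _ hv
  intro w hw
  induction hw using Submodule.iSup_induction' with
  | mem μ w hw => exact Submodule.mem_iSup_of_mem μ (mem_schurWeylSummand.2 hw)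
  | zero => simp
  | add x y _ _ hx hy => rw [map_add]; exact add_mem hx hy

theorem orthogonalFamily_schurWeylSummand (N d : ℕ) :
    OrthogonalFamily ℂ (fun μ : BoundedDiagram N d => schurWeylSummand μ)
      fun μ => (schurWeylSummand μ).subtypeₗᵢ :=
  fun _ _ hμν u w => inner_eq_zero_of_mem_schurWeylSummand hμν u.2 w.2

theorem sum_starProjection_schurWeylSummand {N d : ℕ} (v : EuclideanSpace ℂ (Fin N → Fin d)) :
    ∑ μ : BoundedDiagram N d, (schurWeylSummand μ).starProjection v = v :=
  (orthogonalFamily_schurWeylSummand N d).sum_projection_of_mem_iSup v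
    (iSup_schurWeylSummand N d ▸ Submodule.mem_top)

theorem starProjection_of_mem_ne {N d : ℕ} {μ ν : BoundedDiagram N d} (hμν : μ ≠ ν)
    {v : EuclideanSpace ℂ (Fin N → Fin d)} (hv : v ∈ schurWeylSummand ν) :
    (schurWeylSummand μ).starProjection v = 0 := by
  rw [Submodule.starProjection_apply_eq_zero_iff, Submodule.mem_orthogonal]
  exact fun u hu => inner_eq_zero_of_mem_schurWeylSummand hμν hu hv

theorem starProjection_permRep {N d : ℕ} (μ : BoundedDiagram N d) (g : Equiv.Perm (Fin N))
    (v : EuclideanSpace ℂ (Fin N → Fin d)) :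
    (schurWeylSummand μ).starProjection (permRep N d g v) =
      permRep N d g ((schurWeylSummand μ).starProjection v) := by
  conv_lhs => rw [← sum_starProjection_schurWeylSummand v, map_sum, map_sum]
  rw [Finset.sum_eq_single μ]
  · exact Submodule.starProjection_eq_self_iff.2
      (permRep_mem_schurWeylSummand (Submodule.starProjection_apply_mem _ _) g)
  · intro ν _ hν
    exact starProjection_of_mem_ne hν.symm
      (permRep_mem_schurWeylSummand (Submodule.starProjection_apply_mem _ _) g)
  · simp

/-- Central elements of the group algebra act as linear combinations of the projections onto the
summands of the Schur-Weyl decomposition. -/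
theorem exists_asAlgebraHom_eq_sum {N d : ℕ} {z : SymAlgebra N} (hz : ∀ x, x * z = z * x) :
    ∃ ζ : BoundedDiagram N d → ℂ, ∀ v, (permRep N d).asAlgebraHom z v =
      ∑ μ, ζ μ • (schurWeylSummand μ).starProjection v := by
  choose ζ _ hζ using fun μ : BoundedDiagram N d => exists_asAlgebraHom_eq_smul hz μ
  refine ⟨ζ, fun v => ?_⟩
  conv_lhs => rw [← sum_starProjection_schurWeylSummand v, map_sum]
  exact Finset.sum_congr rfl fun μ _ => hζ μ _ (Submodule.starProjection_apply_mem _ _)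

/-! ### Tensor powers of matrices -/

section TensorPower

variable {ι : Type*} {N : ℕ}

theorem tensorPower_apply (A : Matrix ι ι ℂ) (x y : Fin N → ι) :
    tensorPower A N x y = ∏ i, A (x i) (y i) := rfl

theorem tensorPower_mul [Fintype ι] (A B : Matrix ι ι ℂ) :
    tensorPower (A * B) N = tensorPower A N * tensorPower B N := by
  ext x y
  simp only [tensorPower_apply, Matrix.mul_apply, Finset.prod_univ_sum, Fintype.piFinset_univ,
    Finset.prod_mul_distrib]

theorem tensorPower_diagonal [DecidableEq ι] (D : ι → ℂ) :
    tensorPower (Matrix.diagonal D) N = Matrix.diagonal fun x => ∏ i, D (x i) := by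
  ext x y
  rw [tensorPower_apply]
  by_cases h : x = y
  · subst h
    simp
  · rw [Matrix.diagonal_apply_ne _ h]
    obtain ⟨i, hi⟩ := Function.ne_iff.1 h
    exact Finset.prod_eq_zero (Finset.mem_univ i) (Matrix.diagonal_apply_ne _ hi)

theorem tensorPower_one [DecidableEq ι] : tensorPower (1 : Matrix ι ι ℂ) N = 1 := by
  rw [← Matrix.diagonal_one, tensorPower_diagonal]
  simp

theorem tensorPower_conjTranspose (A : Matrix ι ι ℂ) :
    tensorPower A.conjTranspose N = (tensorPower A N).conjTranspose := by
  ext x y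
  simp [tensorPower_apply, Matrix.conjTranspose_apply]

variable [Fintype ι] [DecidableEq ι]

/-- Phases already detect letter counts: with a primitive `(N + 1)`-th root of unity on letter `a`
and 1 elsewhere, the product is a power whose exponent, the number of `a`'s, is at most `N` and so
is determined. -/
theorem prod_comp_eq_of_phases {x y : Fin N → ι}
    (h : ∀ D : ι → ℂ, (∀ a, ‖D a‖ = 1) → ∏ i, D (x i) = ∏ i, D (y i)) (D : ι → ℂ) :
    ∏ i, D (x i) = ∏ i, D (y i) := by
  have hζ := Complex.isPrimitiveRoot_exp (N + 1) (Nat.succ_ne_zero N)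
  set ζ := Complex.exp (2 * Real.pi * Complex.I / ((N + 1 : ℕ) : ℂ))
  have key : ∀ (x : Fin N → ι) (a : ι), ∏ i, (if x i = a then ζ else 1) =
      ζ ^ (Finset.univ.filter fun i => x i = a).card := by
    intro x a
    rw [Finset.prod_ite]
    simp
  have hcard : ∀ x : Fin N → ι, ∀ a, (Finset.univ.filter fun i => x i = a).card < N + 1 :=
    fun x a => Nat.lt_succ_of_le ((Finset.card_le_univ _).trans (by simp))
  have hcount : ∀ a, (Finset.univ.filter fun i => x i = a).card =
      (Finset.univ.filter fun i => y i = a).card := by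
    intro a
    have h1 := h (fun b => if b = a then ζ else 1) fun b => by
      split_ifs
      · exact hζ.norm'_eq_one (Nat.succ_ne_zero N)
      · simp
    simp only [key] at h1
    exact hζ.pow_inj (hcard x a) (hcard y a) h1
  have hprod : ∀ x : Fin N → ι, ∏ i, D (x i) =
      ∏ a, D a ^ (Finset.univ.filter fun i => x i = a).card := by
    intro x
    rw [← Finset.prod_fiberwise Finset.univ x]
    refine Finset.prod_congr rfl fun a _ => ?_
    rw [Finset.prod_congr rfl fun i hi => by rw [(Finset.mem_filter.1 hi).2], Finset.prod_const]
  rw [hprod, hprod]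
  simp only [hcount]

theorem commute_tensorPower_diagonal {Z : Matrix (Fin N → ι) (Fin N → ι) ℂ}
    (h : ∀ D : ι → ℂ, (∀ a, ‖D a‖ = 1) → Commute Z (tensorPower (Matrix.diagonal D) N))
    (D : ι → ℂ) : Commute Z (tensorPower (Matrix.diagonal D) N) := by
  have entry : ∀ (D : ι → ℂ) x y, (Z * tensorPower (Matrix.diagonal D) N) x y =
      Z x y * ∏ i, D (y i) ∧ (tensorPower (Matrix.diagonal D) N * Z) x y =
        Z x y * ∏ i, D (x i) := by
    intro D x y
    rw [tensorPower_diagonal, Matrix.mul_diagonal, Matrix.diagonal_mul]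
    exact ⟨rfl, mul_comm _ _⟩
  ext x y
  rw [(entry D x y).1, (entry D x y).2]
  by_cases hZ : Z x y = 0
  · rw [hZ, zero_mul, zero_mul]
  · congr 1
    refine (prod_comp_eq_of_phases (fun D hD => ?_) D).symm
    have h1 := congrFun (congrFun (h D hD).eq x) y
    rw [(entry D x y).1, (entry D x y).2] at h1
    exact (mul_left_cancel₀ hZ h1).symm

theorem commute_tensorPower_isHermitian {Z : Matrix (Fin N → ι) (Fin N → ι) ℂ}
    (h : ∀ U ∈ Matrix.unitaryGroup ι ℂ, Commute Z (tensorPower U N))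
    {H : Matrix ι ι ℂ} (hH : H.IsHermitian) : Commute Z (tensorPower H N) := by
  have hW := hH.eigenvectorUnitary.2
  set W : Matrix ι ι ℂ := (hH.eigenvectorUnitary : Matrix ι ι ℂ) with hWdef
  have h1 : tensorPower W N * tensorPower (star W) N = 1 := by
    rw [← tensorPower_mul, Matrix.mem_unitaryGroup_iff.1 hW, tensorPower_one]
  have h2 : tensorPower (star W) N * tensorPower W N = 1 := by
    rw [← tensorPower_mul, Matrix.mem_unitaryGroup_iff'.1 hW, tensorPower_one]
  have key : ∀ D : ι → ℂ, Commute (tensorPower (star W) N * Z * tensorPower W N)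
      (tensorPower (Matrix.diagonal D) N) ↔
        Commute Z (tensorPower (W * Matrix.diagonal D * star W) N) := by
    intro D
    rw [tensorPower_mul, tensorPower_mul]
    generalize tensorPower W N = w at *
    generalize tensorPower (star W) N = w' at *
    generalize tensorPower (Matrix.diagonal D) N = D'
    constructor
    · intro h
      have h3 := congrArg (fun m => w * m * w') h.eq
      change Z * (w * D' * w') = w * D' * w' * Z
      calc Z * (w * D' * w') = (w * w') * Z * (w * D' * w') := by rw [h1, one_mul]
        _ = w * (w' * Z * w * D') * w' := by simp only [mul_assoc]
        _ = w * (D' * (w' * Z * w)) * w' := h3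
        _ = w * D' * w' * Z * (w * w') := by simp only [mul_assoc]
        _ = w * D' * w' * Z := by rw [h1, mul_one]
    · intro h
      have h3 := congrArg (fun m => w' * m * w) h.eq
      change w' * Z * w * D' = D' * (w' * Z * w)
      calc w' * Z * w * D' = w' * Z * w * D' * (w' * w) := by rw [h2, mul_one]
        _ = w' * (Z * (w * D' * w')) * w := by simp only [mul_assoc]
        _ = w' * (w * D' * w' * Z) * w := h3
        _ = (w' * w) * D' * (w' * Z * w) := by simp only [mul_assoc]
        _ = D' * (w' * Z * w) := by rw [h2, one_mul]
  have h3 := hH.spectral_theorem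
  rw [Unitary.conjStarAlgAut_apply, ← hWdef] at h3
  rw [h3, ← key]
  refine commute_tensorPower_diagonal (fun D hD => (key D).2 (h _ ?_)) _
  refine mul_mem (mul_mem hW ?_) (Unitary.star_mem hW)
  rw [Matrix.mem_unitaryGroup_iff, Matrix.star_eq_conjTranspose, Matrix.diagonal_conjTranspose,
    Matrix.diagonal_mul_diagonal, ← Matrix.diagonal_one]
  congr 1
  funext a
  have := Complex.mul_conj' (D a)
  simpa [hD] using this

/-- Weyl's unitary trick: unitaries give Hermitian matrices by diagonalization, and `C = H + iK` is
reached by continuing a polynomial identity. -/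
theorem commute_tensorPower {Z : Matrix (Fin N → ι) (Fin N → ι) ℂ}
    (h : ∀ U ∈ Matrix.unitaryGroup ι ℂ, Commute Z (tensorPower U N))
    (C : Matrix ι ι ℂ) : Commute Z (tensorPower C N) := by
  have hHK : ∃ H K : Matrix ι ι ℂ, H.IsHermitian ∧ K.IsHermitian ∧ C = H + Complex.I • K := by
    refine ⟨realPart C, imaginaryPart C, (realPart C).2, (imaginaryPart C).2, ?_⟩
    exact (realPart_add_I_smul_imaginaryPart C).symm
  obtain ⟨H, K, hH, hK, rfl⟩ := hHK
  ext x y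
  -- An entry of the commutator with `(H + tK)^{⊗N}`, as a polynomial in `t`. It vanishes for real
  -- `t`, where `H + tK` is Hermitian, hence at `t = i`.
  let Q : Polynomial ℂ :=
    ∑ z, Polynomial.C (Z x z) *
        ∏ i, (Polynomial.C (H (z i) (y i)) + Polynomial.X * Polynomial.C (K (z i) (y i))) -
      ∑ z, (∏ i, (Polynomial.C (H (x i) (z i)) + Polynomial.X * Polynomial.C (K (x i) (z i)))) *
        Polynomial.C (Z z y)
  have hQ : ∀ t : ℂ, Q.eval t =
      (Z * tensorPower (H + t • K) N) x y - (tensorPower (H + t • K) N * Z) x y := by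
    intro t
    simp [Q, Matrix.mul_apply, tensorPower_apply, Polynomial.eval_finsetSum,
      Polynomial.eval_prod, mul_comm t]
  have hQ0 : Q = 0 := by
    refine Polynomial.eq_zero_of_infinite_isRoot Q
      ((Set.infinite_range_of_injective Complex.ofReal_injective).mono ?_)
    rintro _ ⟨t, rfl⟩
    have h1 : (H + (t : ℂ) • K).IsHermitian := by
      refine hH.add ?_
      rw [Matrix.IsHermitian, Matrix.conjTranspose_smul, hK.eq]
      simp
    change Q.eval _ = 0
    rw [hQ, (commute_tensorPower_isHermitian h h1).eq, sub_self]
  have h2 := hQ Complex.I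
  rw [hQ0, Polynomial.eval_zero] at h2
  exact (sub_eq_zero.1 h2.symm)

/-- Polarization: the hypothesis is a polynomial in `s` that vanishes identically, and the sum over
permutations is its coefficient at the monomial in which each variable occurs once. -/
theorem sum_perm_eq_zero_of_forall (c : (Fin N → Fin N) → ℂ)
    (h : ∀ s : Fin N → ℂ, ∑ f : Fin N → Fin N, (∏ i, s (f i)) * c f = 0) :
    ∑ σ : Equiv.Perm (Fin N), c σ = 0 := by
  classical
  let Q : MvPolynomial (Fin N) ℂ :=
    ∑ f : Fin N → Fin N, MvPolynomial.monomial (∑ i, Finsupp.single (f i) 1) (c f)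
  have hQ : Q = 0 := by
    apply MvPolynomial.funext
    intro s
    rw [map_zero, ← h s, map_sum]
    refine Finset.sum_congr rfl fun f _ => ?_
    rw [MvPolynomial.eval_monomial, mul_comm]
    congr 1
    rw [Finsupp.prod_fintype _ _ (by simp)]
    simp only [Finsupp.coe_finsetSum, Finset.sum_apply, ← Finset.prod_pow_eq_pow_sum]
    rw [Finset.prod_comm]
    refine Finset.prod_congr rfl fun i _ => ?_
    rw [Finset.prod_eq_single (f i)]
    · simp
    · intro j _ hj
      rw [Finsupp.single_eq_of_ne hj, pow_zero]
    · simp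
  have h1 := congrArg (MvPolynomial.coeff (∑ i : Fin N, Finsupp.single i 1)) hQ
  rw [MvPolynomial.coeff_sum, MvPolynomial.coeff_zero] at h1
  simp only [MvPolynomial.coeff_monomial] at h1
  rw [← Finset.sum_filter] at h1
  rw [← h1]
  refine Finset.sum_bij (fun σ _ => (σ : Fin N → Fin N)) ?_ ?_ ?_ (fun _ _ => rfl)
  · intro σ _
    rw [Finset.mem_filter]
    exact ⟨Finset.mem_univ _, Equiv.sum_comp σ fun i => Finsupp.single i 1⟩
  · intro σ _ τ _ h
    exact DFunLike.coe_injective h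
  · intro f hf
    have hf' := (Finset.mem_filter.1 hf).2
    have hsurj : Function.Surjective f := by
      intro j
      by_contra! hj
      have h2 := DFunLike.congr_fun hf' j
      simp only [Finsupp.coe_finsetSum, Finset.sum_apply] at h2
      rw [Finset.sum_eq_zero fun i _ => Finsupp.single_eq_of_ne (hj i).symm,
        Finset.sum_eq_single j (fun i _ hi => Finsupp.single_eq_of_ne hi.symm) (by simp)] at h2
      simp at h2
    exact ⟨Equiv.ofBijective f (Finite.surjective_iff_bijective.1 hsurj), Finset.mem_univ _, rfl⟩

/-- The sum over all permutations of the tensor factors of the matrix unit `|x⟩⟨y|`. -/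
def symUnit (x y : Fin N → ι) : Matrix (Fin N → ι) (Fin N → ι) ℂ :=
  ∑ σ : Equiv.Perm (Fin N), Matrix.single (x ∘ σ) (y ∘ σ) 1

/-- For `C = ∑ j, s j |x₀ j⟩⟨y₀ j|`, the multilinear coefficient in `s` of `C^{⊗N}` is `symUnit x₀
y₀`. -/
theorem commute_symUnit {Z : Matrix (Fin N → ι) (Fin N → ι) ℂ}
    (h : ∀ C : Matrix ι ι ℂ, Commute Z (tensorPower C N)) (x₀ y₀ : Fin N → ι) :
    Commute Z (symUnit x₀ y₀) := by
  have hT : ∀ s : Fin N → ℂ, tensorPower (∑ j, Matrix.single (x₀ j) (y₀ j) (s j)) N =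
      ∑ f : Fin N → Fin N, (∏ i, s (f i)) • Matrix.single (x₀ ∘ f) (y₀ ∘ f) (1 : ℂ) := by
    intro s
    ext x y
    simp only [tensorPower_apply, Matrix.sum_apply, Finset.prod_univ_sum, Fintype.piFinset_univ]
    refine Finset.sum_congr rfl fun f _ => ?_
    simp only [Matrix.smul_apply, Matrix.single_apply, smul_eq_mul, mul_ite, mul_one, mul_zero]
    by_cases hf : x₀ ∘ f = x ∧ y₀ ∘ f = y
    · obtain ⟨rfl, rfl⟩ := hf
      simp
    · rw [if_neg hf]
      rw [not_and_or, ← Ne.eq_def, ← Ne.eq_def, Function.ne_iff, Function.ne_iff] at hf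
      rcases hf with ⟨i, hi⟩ | ⟨i, hi⟩
      · exact Finset.prod_eq_zero (Finset.mem_univ i) (if_neg fun h => hi h.1)
      · exact Finset.prod_eq_zero (Finset.mem_univ i) (if_neg fun h => hi h.2)
  ext x y
  rw [symUnit, Finset.mul_sum, Finset.sum_mul, Matrix.sum_apply, Matrix.sum_apply, ← sub_eq_zero,
    ← Finset.sum_sub_distrib]
  refine sum_perm_eq_zero_of_forall (fun f => (Z * Matrix.single (x₀ ∘ f) (y₀ ∘ f) (1 : ℂ)) x y -
    (Matrix.single (x₀ ∘ f) (y₀ ∘ f) (1 : ℂ) * Z) x y) fun s => ?_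
  have h1 := congrFun (congrFun (h (∑ j, Matrix.single (x₀ j) (y₀ j) (s j))).eq x) y
  rw [hT, Finset.mul_sum, Finset.sum_mul, Matrix.sum_apply, Matrix.sum_apply, ← sub_eq_zero,
    ← Finset.sum_sub_distrib] at h1
  rw [← h1]
  refine Finset.sum_congr rfl fun f _ => ?_
  rw [Matrix.mul_smul, Matrix.smul_mul, Matrix.smul_apply, Matrix.smul_apply, smul_eq_mul,
    smul_eq_mul, mul_sub]

end TensorPower

/-! ### Operators that commute with local tensor powers -/

section Bipartite

variable {m n : Type*} [Fintype m] [Fintype n]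

theorem commute_kronecker_one_iff [DecidableEq n] {X : Matrix (m × n) (m × n) ℂ} {M : Matrix m m ℂ} :
    Commute X (M ⊗ₖ (1 : Matrix n n ℂ)) ↔
      ∀ b b', Commute (Matrix.of fun x y => X (x, b) (y, b')) M := by
  have h1 : ∀ x b y b', (X * (M ⊗ₖ (1 : Matrix n n ℂ))) (x, b) (y, b') =
      (Matrix.of (fun x y => X (x, b) (y, b')) * M) x y := by
    intro x b y b'
    simp [Matrix.mul_apply, Fintype.sum_prod_type, Matrix.one_apply]
  have h2 : ∀ x b y b', ((M ⊗ₖ (1 : Matrix n n ℂ)) * X) (x, b) (y, b') =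
      (M * Matrix.of (fun x y => X (x, b) (y, b'))) x y := by
    intro x b y b'
    simp [Matrix.mul_apply, Fintype.sum_prod_type, Matrix.one_apply]
  constructor
  · intro h b b'
    ext x y
    rw [← h1, ← h2, h.eq]
  · intro h
    ext ⟨x, b⟩ ⟨y, b'⟩
    rw [h1, h2, (h b b').eq]

theorem commute_one_kronecker_iff [DecidableEq m] {X : Matrix (m × n) (m × n) ℂ} {M : Matrix n n ℂ} :
    Commute X ((1 : Matrix m m ℂ) ⊗ₖ M) ↔
      ∀ a a', Commute (Matrix.of fun x y => X (a, x) (a', y)) M := by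
  have h1 : ∀ a x a' y, (X * ((1 : Matrix m m ℂ) ⊗ₖ M)) (a, x) (a', y) =
      (Matrix.of (fun x y => X (a, x) (a', y)) * M) x y := by
    intro a x a' y
    simp [Matrix.mul_apply, Fintype.sum_prod_type, Matrix.one_apply]
  have h2 : ∀ a x a' y, (((1 : Matrix m m ℂ) ⊗ₖ M) * X) (a, x) (a', y) =
      (M * Matrix.of (fun x y => X (a, x) (a', y))) x y := by
    intro a x a' y
    simp [Matrix.mul_apply, Fintype.sum_prod_type, Matrix.one_apply]
  constructor
  · intro h b b'
    ext x y
    rw [← h1, ← h2, h.eq]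
  · intro h
    ext ⟨x, b⟩ ⟨y, b'⟩
    rw [h1, h2, (h x y).eq]

end Bipartite

theorem comp_perm_eq_iff {γ : Type*} {N : ℕ} {σ : Equiv.Perm (Fin N)} {f g : Fin N → γ} :
    f ∘ σ = g ↔ f = g ∘ ⇑σ⁻¹ := by
  constructor
  · rintro rfl
    funext i
    simp
  · rintro rfl
    funext i
    simp

section DoubleCommutant

variable {α β : Type*} {N : ℕ}

/-- The action of two permutations on the tensor factors of the two parties. -/
def pairRep (α β : Type*) (N : ℕ) :
    Representation ℂ (Equiv.Perm (Fin N) × Equiv.Perm (Fin N))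
      ((Fin N → α) × (Fin N → β) → ℂ) where
  toFun p :=
    { toFun := fun v w => v (w.1 ∘ p.1, w.2 ∘ p.2)
      map_add' := fun _ _ => rfl
      map_smul' := fun _ _ => rfl }
  map_one' := rfl
  map_mul' _ _ := rfl

variable [Fintype α] [Fintype β] [DecidableEq α] [DecidableEq β]

/-- Averaging the expansion of `Y` in matrix units over both permutation groups writes `Y` through
products `symUnit ⊗ symUnit`, and `X` commutes with each factor. -/
theorem commute_of_invariant
    {X Y : Matrix ((Fin N → α) × (Fin N → β)) ((Fin N → α) × (Fin N → β)) ℂ}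
    (hA : ∀ U ∈ Matrix.unitaryGroup α ℂ, Commute X (tensorPower U N ⊗ₖ 1))
    (hB : ∀ U ∈ Matrix.unitaryGroup β ℂ, Commute X (1 ⊗ₖ tensorPower U N))
    (hY : ∀ (π σ : Equiv.Perm (Fin N)) v w,
      Y (v.1 ∘ π, v.2 ∘ σ) (w.1 ∘ π, w.2 ∘ σ) = Y v w) : Commute X Y := by
  have h1 : ∀ v w : (Fin N → α) × (Fin N → β),
      Commute X (symUnit v.1 w.1 ⊗ₖ symUnit v.2 w.2) := by
    intro v w
    have hA' : Commute X (symUnit v.1 w.1 ⊗ₖ 1) := commute_kronecker_one_iff.2 fun b b' =>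
      commute_symUnit (commute_tensorPower fun U hU =>
        commute_kronecker_one_iff.1 (hA U hU) b b') _ _
    have hB' : Commute X (1 ⊗ₖ symUnit v.2 w.2) := commute_one_kronecker_iff.2 fun a a' =>
      commute_symUnit (commute_tensorPower fun U hU =>
        commute_one_kronecker_iff.1 (hB U hU) a a') _ _
    have := hA'.mul_right hB'
    rwa [← Matrix.mul_kronecker_mul, mul_one, one_mul] at this
  have h2 : ((Nat.factorial N : ℂ) * Nat.factorial N) • Y =
      ∑ v, ∑ w, Y v w • (symUnit v.1 w.1 ⊗ₖ symUnit v.2 w.2) := by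
    ext v' w'
    simp only [Matrix.sum_apply, Matrix.smul_apply, Matrix.kroneckerMap_apply, symUnit,
      Matrix.single_apply, Finset.sum_mul_sum, smul_eq_mul]
    simp only [Finset.mul_sum]
    have h3 : ∀ π σ : Equiv.Perm (Fin N), ∑ v, ∑ w, Y v w *
        ((if v.1 ∘ π = v'.1 ∧ w.1 ∘ π = w'.1 then (1 : ℂ) else 0) *
          if v.2 ∘ σ = v'.2 ∧ w.2 ∘ σ = w'.2 then (1 : ℂ) else 0) = Y v' w' := by
      intro π σ
      rw [Finset.sum_eq_single (v'.1 ∘ ⇑π⁻¹, v'.2 ∘ ⇑σ⁻¹),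
        Finset.sum_eq_single (w'.1 ∘ ⇑π⁻¹, w'.2 ∘ ⇑σ⁻¹), hY]
      · simp only [comp_perm_eq_iff]
        simp
      · intro w _ hw
        simp only [comp_perm_eq_iff, true_and]
        by_cases h1 : w.1 = w'.1 ∘ ⇑π⁻¹
        · rw [if_neg fun h2 => hw (Prod.ext h1 h2), mul_zero, mul_zero]
        · rw [if_neg h1, zero_mul, mul_zero]
      · simp
      · intro v _ hv
        refine Finset.sum_eq_zero fun w _ => ?_
        simp only [comp_perm_eq_iff]
        by_cases h1 : v.1 = v'.1 ∘ ⇑π⁻¹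
        · rw [if_neg fun h2 : v.2 = v'.2 ∘ ⇑σ⁻¹ ∧ _ => hv (Prod.ext h1 h2.1), mul_zero, mul_zero]
        · rw [if_neg fun h2 : v.1 = v'.1 ∘ ⇑π⁻¹ ∧ _ => h1 h2.1, zero_mul, mul_zero]
      · simp
    calc (Nat.factorial N : ℂ) * Nat.factorial N * Y v' w'
        = ∑ _π : Equiv.Perm (Fin N), ∑ _σ : Equiv.Perm (Fin N), Y v' w' := by
          simp [Fintype.card_perm, mul_assoc]
      _ = ∑ π : Equiv.Perm (Fin N), ∑ σ : Equiv.Perm (Fin N), ∑ v, ∑ w, Y v w *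
        ((if v.1 ∘ π = v'.1 ∧ w.1 ∘ π = w'.1 then (1 : ℂ) else 0) *
          if v.2 ∘ σ = v'.2 ∧ w.2 ∘ σ = w'.2 then (1 : ℂ) else 0) := by
          simp only [h3]
      _ = _ := by
          rw [Finset.sum_congr rfl fun π _ => Finset.sum_comm, Finset.sum_comm]
          refine Finset.sum_congr rfl fun v _ => ?_
          rw [Finset.sum_congr rfl fun π _ => Finset.sum_comm, Finset.sum_comm]
  have h3 : Commute X (((Nat.factorial N : ℂ) * Nat.factorial N) • Y) := by
    rw [h2]
    exact Commute.sum_right _ _ _ fun v _ => Commute.sum_right _ _ _ fun w _ =>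
      (h1 v w).smul_right _
  have h4 : ((Nat.factorial N : ℂ) * Nat.factorial N) ≠ 0 :=
    mul_ne_zero (Nat.cast_ne_zero.2 (Nat.factorial_ne_zero N))
      (Nat.cast_ne_zero.2 (Nat.factorial_ne_zero N))
  have h5 := h3.smul_right ((Nat.factorial N : ℂ) * Nat.factorial N)⁻¹
  rwa [smul_smul, inv_mul_cancel₀ h4, one_smul] at h5

/-- An operator that commutes with `U^{⊗N} ⊗ V^{⊗N}` for all unitary `U` and `V` is a linear
combination of permutations of the tensor factors of the two parties. -/
theorem exists_mulVec_eq_sum_perm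
    {X : Matrix ((Fin N → α) × (Fin N → β)) ((Fin N → α) × (Fin N → β)) ℂ}
    (hA : ∀ U ∈ Matrix.unitaryGroup α ℂ, Commute X (tensorPower U N ⊗ₖ 1))
    (hB : ∀ U ∈ Matrix.unitaryGroup β ℂ, Commute X (1 ⊗ₖ tensorPower U N)) :
    ∃ r : Equiv.Perm (Fin N) × Equiv.Perm (Fin N) → ℂ, ∀ v w,
      (X.mulVec v) w = ∑ p, r p * v (w.1 ∘ p.1, w.2 ∘ p.2) := by
  let ρ := pairRep α β N
  let A := MonoidAlgebra ℂ (Equiv.Perm (Fin N) × Equiv.Perm (Fin N))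
  let e := ρ.asModuleEquiv
  -- An endomorphism commuting with all pairs of permutations has an invariant matrix, so it
  -- commutes with `X`: `X` lies in the double commutant.
  have hcomm : ∀ (f : Module.End A ρ.asModule) (v : ρ.asModule),
      X.mulVec (e (f v)) = e (f (e.symm (X.mulVec (e v)))) := by
    intro f v
    let f' : ((Fin N → α) × (Fin N → β) → ℂ) →ₗ[ℂ] ((Fin N → α) × (Fin N → β) → ℂ) :=
      e.toLinearMap ∘ₗ f.restrictScalars ℂ ∘ₗ e.symm.toLinearMap
    have hf' : ∀ p v, f' (ρ p v) = ρ p (f' v) := by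
      intro p v
      have h1 : e.symm (ρ p v) = (MonoidAlgebra.single p (1 : ℂ) : A) • e.symm v := by
        apply e.injective
        rw [LinearEquiv.apply_symm_apply, Representation.asModuleEquiv_map_smul,
          Representation.asAlgebraHom_single, one_smul, LinearEquiv.apply_symm_apply]
      simp only [f', LinearMap.comp_apply, LinearEquiv.coe_coe, LinearMap.restrictScalars_apply]
      rw [h1, map_smul, Representation.asModuleEquiv_map_smul,
          Representation.asAlgebraHom_single, one_smul]
    have hY : Commute X (LinearMap.toMatrix' f') := by
      refine commute_of_invariant hA hB fun π σ v w => ?_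
      rw [LinearMap.toMatrix'_apply, LinearMap.toMatrix'_apply]
      have h2 : (Pi.single w (1 : ℂ) : (Fin N → α) × (Fin N → β) → ℂ) =
          ρ (π, σ) (Pi.single (w.1 ∘ π, w.2 ∘ σ) 1) := by
        funext u
        change _ = (Pi.single (w.1 ∘ π, w.2 ∘ σ) 1 : (Fin N → α) × (Fin N → β) → ℂ)
          (u.1 ∘ π, u.2 ∘ σ)
        rw [Pi.single_apply, Pi.single_apply]
        congr 1
        simp only [Prod.ext_iff, eq_iff_iff]
        rw [π.surjective.injective_comp_right.eq_iff, σ.surjective.injective_comp_right.eq_iff]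
      rw [h2, hf']
      rfl
    have h3 := congrArg (fun M => M.mulVec (e v)) hY.eq
    simp only [← Matrix.mulVec_mulVec, LinearMap.toMatrix'_mulVec] at h3
    simpa [f'] using h3
  let F : Module.End (Module.End A ρ.asModule) ρ.asModule :=
    { toFun := fun v => e.symm (X.mulVec (e v))
      map_add' := fun v w => by rw [map_add, Matrix.mulVec_add, map_add]
      map_smul' := fun f v => by
        rw [Module.End.smul_def, RingHom.id_apply, Module.End.smul_def, hcomm,
          LinearEquiv.symm_apply_apply] }
  classical
  -- Density on the finite set of standard basis vectors yields one group algebra element that acts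
  -- as `X` everywhere.
  obtain ⟨r, hr⟩ := jacobson_density F
    (Finset.univ.image fun w => e.symm (Pi.single w (1 : ℂ)))
  have h4 : X.mulVecLin = ρ.asAlgebraHom r := by
    refine LinearMap.pi_ext' fun w => LinearMap.ext_ring ?_
    have h5 := hr (e.symm (Pi.single w 1)) (Finset.mem_image_of_mem _ (Finset.mem_univ w))
    have h6 := congrArg e h5
    rw [Representation.asModuleEquiv_map_smul, show ρ.asModuleEquiv (e.symm (Pi.single w 1)) =
      Pi.single w 1 from e.apply_symm_apply _] at h6
    simpa [F] using h6
  refine ⟨fun p => r.coeff p, fun v w => ?_⟩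
  have h7 := congrFun (LinearMap.congr_fun h4 v) w
  rw [Matrix.mulVecLin_apply] at h7
  rw [h7, Representation.asAlgebraHom_def, MonoidAlgebra.lift_apply, Finsupp.sum_fintype _ _
    (by simp), LinearMap.sum_apply, Finset.sum_apply]
  rfl

end DoubleCommutant

/-! ### Reduction to weak Schur sampling on the symmetric subspace -/

section Symmetric

variable {N d : ℕ} {β : Type*}

/-- `v` lies in the symmetric subspace of the `N`-th tensor power of a bipartite space. -/
def IsSymmetricVector {α : Type*} (v : (Fin N → α) × (Fin N → β) → ℂ) : Prop :=
  ∀ (g : Equiv.Perm (Fin N)) w, v (w.1 ∘ g, w.2 ∘ g) = v w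

/-- The component of `v` along a standard basis vector of the second party. -/
def slice (v : (Fin N → Fin d) × (Fin N → β) → ℂ) (y : Fin N → β) :
    EuclideanSpace ℂ (Fin N → Fin d) :=
  WithLp.toLp 2 fun x => v (x, y)

theorem slice_apply (v : (Fin N → Fin d) × (Fin N → β) → ℂ) (y : Fin N → β) (x : Fin N → Fin d) :
    slice v y x = v (x, y) := rfl

theorem IsSymmetricVector.slice_comp {v : (Fin N → Fin d) × (Fin N → β) → ℂ}
    (hv : IsSymmetricVector v) (g : Equiv.Perm (Fin N)) (y : Fin N → β) :
    slice v (y ∘ g) = permRep N d g⁻¹ (slice v y) := by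
  ext x
  rw [slice_apply, permRep_apply, slice_apply, ← hv g (x ∘ ⇑g⁻¹, y)]
  congr 2
  funext i
  simp

/-- The projection of a vector onto a summand of the Schur-Weyl decomposition of the first party. -/
def localProjection (μ : BoundedDiagram N d) (v : (Fin N → Fin d) × (Fin N → β) → ℂ) :
    (Fin N → Fin d) × (Fin N → β) → ℂ :=
  fun w => (schurWeylSummand μ).starProjection (slice v w.2) w.1

theorem slice_localProjection (μ : BoundedDiagram N d) (v : (Fin N → Fin d) × (Fin N → β) → ℂ)
    (y : Fin N → β) :
    slice (localProjection μ v) y = (schurWeylSummand μ).starProjection (slice v y) := rfl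

theorem IsSymmetricVector.localProjection {v : (Fin N → Fin d) × (Fin N → β) → ℂ}
    (hv : IsSymmetricVector v) (μ : BoundedDiagram N d) :
    IsSymmetricVector (localProjection μ v) := by
  intro g w
  rw [_root_.localProjection, _root_.localProjection, hv.slice_comp, starProjection_permRep,
    permRep_apply]
  refine congrArg ((schurWeylSummand μ).starProjection (slice v w.2)).ofLp ?_
  funext i
  simp

variable [Fintype β]

/-- Symmetry of `v` trades `σ` on the second party for `σ⁻¹` on the first. Relabelling the summation
by `g` then conjugates the result, and the freedom in `g` is what permits averaging to a central
element. -/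
theorem IsSymmetricVector.sum_comp {u v : (Fin N → Fin d) × (Fin N → β) → ℂ}
    (hu : IsSymmetricVector u) (hv : IsSymmetricVector v) (g π σ : Equiv.Perm (Fin N)) :
    ∑ w : (Fin N → Fin d) × (Fin N → β), star (u w) * v (w.1 ∘ π, w.2 ∘ σ) =
      ∑ w : (Fin N → Fin d) × (Fin N → β), star (u w) * v (w.1 ∘ ⇑(g * (π * σ⁻¹) * g⁻¹), w.2) := by
  have h1 : ∀ w : (Fin N → Fin d) × (Fin N → β), v (w.1 ∘ π, w.2 ∘ σ) = v (w.1 ∘ ⇑(π * σ⁻¹), w.2) := by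
    intro w
    rw [← hv σ⁻¹]
    congr 2
    funext i
    simp
  simp only [h1]
  refine (Fintype.sum_equiv ((Equiv.arrowCongr g.symm (Equiv.refl _)).prodCongr
    (Equiv.arrowCongr g.symm (Equiv.refl _))) _ _ fun w => ?_).symm
  change _ = star (u (w.1 ∘ g, w.2 ∘ g)) * v ((w.1 ∘ g) ∘ ⇑(π * σ⁻¹), w.2 ∘ g)
  rw [hu g w, ← hv g (w.1 ∘ ⇑(g * (π * σ⁻¹) * g⁻¹), w.2)]
  congr 3
  funext i
  simp

theorem dotProduct_eq_sum_slice (v : (Fin N → Fin d) × (Fin N → β) → ℂ) :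
    star v ⬝ᵥ v = ∑ y, inner ℂ (slice v y) (slice v y) := by
  rw [dotProduct, Fintype.sum_prod_type_right]
  refine Finset.sum_congr rfl fun y _ => ?_
  rw [PiLp.inner_apply]
  refine Finset.sum_congr rfl fun x _ => ?_
  rw [RCLike.inner_apply, mul_comm, slice_apply]
  rfl

variable [DecidableEq β]

/-- On the symmetric subspace, an operator that commutes with `U^{⊗N} ⊗ V^{⊗N}` for all unitary `U`
and `V` is a linear combination of the operators of local weak Schur sampling. -/
theorem exists_dotProduct_mulVec_eq_sum
    {X : Matrix ((Fin N → Fin d) × (Fin N → β)) ((Fin N → Fin d) × (Fin N → β)) ℂ}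
    (hA : ∀ U ∈ Matrix.unitaryGroup (Fin d) ℂ, Commute X (tensorPower U N ⊗ₖ 1))
    (hB : ∀ U ∈ Matrix.unitaryGroup β ℂ, Commute X (1 ⊗ₖ tensorPower U N)) :
    ∃ ζ : BoundedDiagram N d → ℂ, ∀ u v, IsSymmetricVector u → IsSymmetricVector v →
      star u ⬝ᵥ X.mulVec v = ∑ μ, ζ μ *
        ∑ y, inner ℂ (slice u y) ((schurWeylSummand μ).starProjection (slice v y)) := by
  obtain ⟨r, hr⟩ := exists_mulVec_eq_sum_perm hA hB
  -- All permutations transferred to the first party; `conjSum z₀` is its central average, up to the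
  -- factor `N!`.
  set z₀ : SymAlgebra N := ∑ p, MonoidAlgebra.single (p.1 * p.2⁻¹) (r p) with hz₀
  obtain ⟨ζ, hζ⟩ := exists_asAlgebraHom_eq_sum (d := d) (mul_conjSum z₀)
  have hN : (Nat.factorial N : ℂ) ≠ 0 := Nat.cast_ne_zero.2 (Nat.factorial_ne_zero N)
  refine ⟨fun μ => (Nat.factorial N : ℂ)⁻¹ * ζ μ, fun u v hu hv => ?_⟩
  have h1 : (Nat.factorial N : ℂ) * (star u ⬝ᵥ X.mulVec v) =
      ∑ y, inner ℂ (slice u y) ((permRep N d).asAlgebraHom (conjSum z₀) (slice v y)) := by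
    have h2 : ∀ y x, (permRep N d).asAlgebraHom (conjSum z₀) (slice v y) x =
        ∑ g : Equiv.Perm (Fin N), ∑ p, r p * v (x ∘ ⇑(g * (p.1 * p.2⁻¹) * g⁻¹), y) := by
      intro y x
      simp only [conjSum, hz₀, Finset.mul_sum, Finset.sum_mul, MonoidAlgebra.single_mul_single,
        map_sum, Representation.asAlgebraHom_single, one_mul, mul_one, LinearMap.sum_apply,
        LinearMap.smul_apply, WithLp.ofLp_sum, Finset.sum_apply, PiLp.smul_apply, permRep_apply,
        slice_apply, smul_eq_mul]
    have h3 : star u ⬝ᵥ X.mulVec v = ∑ p, r p *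
        ∑ w : (Fin N → Fin d) × (Fin N → β), star (u w) * v (w.1 ∘ p.1, w.2 ∘ p.2) := by
      simp only [dotProduct, hr, Finset.mul_sum, Pi.star_apply]
      rw [Finset.sum_comm]
      exact Finset.sum_congr rfl fun p _ => Finset.sum_congr rfl fun w _ => by ring
    calc (Nat.factorial N : ℂ) * (star u ⬝ᵥ X.mulVec v)
        = ∑ _g : Equiv.Perm (Fin N), star u ⬝ᵥ X.mulVec v := by simp [Fintype.card_perm]
      _ = ∑ g : Equiv.Perm (Fin N), ∑ p, r p *
          ∑ w : (Fin N → Fin d) × (Fin N → β),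
            star (u w) * v (w.1 ∘ ⇑(g * (p.1 * p.2⁻¹) * g⁻¹), w.2) := by
          refine Finset.sum_congr rfl fun g _ => ?_
          rw [h3]
          exact Finset.sum_congr rfl fun p _ => by rw [hu.sum_comp hv g]
      _ = ∑ w : (Fin N → Fin d) × (Fin N → β), star (u w) *
          ∑ g : Equiv.Perm (Fin N), ∑ p, r p * v (w.1 ∘ ⇑(g * (p.1 * p.2⁻¹) * g⁻¹), w.2) := by
          simp only [Finset.mul_sum]
          rw [Finset.sum_congr rfl fun g _ => Finset.sum_comm, Finset.sum_comm]
          exact Finset.sum_congr rfl fun w _ => Finset.sum_congr rfl fun g _ =>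
            Finset.sum_congr rfl fun p _ => by ring
      _ = _ := by
          rw [Fintype.sum_prod_type_right]
          refine Finset.sum_congr rfl fun y _ => ?_
          rw [PiLp.inner_apply]
          refine Finset.sum_congr rfl fun x _ => ?_
          rw [h2, RCLike.inner_apply, mul_comm, slice_apply]
          rfl
  rw [← mul_right_inj' hN, h1, Finset.mul_sum]
  simp only [hζ, inner_sum, inner_smul_right]
  rw [Finset.sum_comm]
  refine Finset.sum_congr rfl fun μ _ => ?_
  rw [← mul_assoc, ← mul_assoc, mul_inv_cancel₀ hN, one_mul, Finset.mul_sum]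

/-- The projection of a symmetric vector to one summand is again symmetric and sees only the scalar
of that summand, so `0 ≤ X ≤ 1` bounds the scalar whenever such a projection is nonzero. -/
theorem exists_acceptance_probabilities
    {X : Matrix ((Fin N → Fin d) × (Fin N → β)) ((Fin N → Fin d) × (Fin N → β)) ℂ}
    (hX : X.PosSemidef) (hX' : (1 - X).PosSemidef)
    (hA : ∀ U ∈ Matrix.unitaryGroup (Fin d) ℂ, Commute X (tensorPower U N ⊗ₖ 1))
    (hB : ∀ U ∈ Matrix.unitaryGroup β ℂ, Commute X (1 ⊗ₖ tensorPower U N)) :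
    ∃ f : BoundedDiagram N d → ℝ, (∀ μ, 0 ≤ f μ ∧ f μ ≤ 1) ∧ ∀ v, IsSymmetricVector v →
      star v ⬝ᵥ X.mulVec v = ∑ μ, (f μ : ℂ) *
        ∑ y, inner ℂ (slice v y) ((schurWeylSummand μ).starProjection (slice v y)) := by
  classical
  obtain ⟨ζ, hζ⟩ := exists_dotProduct_mulVec_eq_sum hA hB
  have key : ∀ μ (v : (Fin N → Fin d) × (Fin N → β) → ℂ), IsSymmetricVector v → localProjection μ v ≠ 0 →
      ((ζ μ).re : ℂ) = ζ μ ∧ 0 ≤ (ζ μ).re ∧ (ζ μ).re ≤ 1 := by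
    intro μ v hv h0
    set w := localProjection μ v with hw
    have hws := hv.localProjection μ
    have h1 : star w ⬝ᵥ X.mulVec w = ζ μ * (star w ⬝ᵥ w) := by
      rw [hζ w w hws hws, Finset.sum_eq_single μ, dotProduct_eq_sum_slice]
      · congr 1
        refine Finset.sum_congr rfl fun y _ => ?_
        rw [hw, slice_localProjection, Submodule.starProjection_eq_self_iff.2
          (Submodule.starProjection_apply_mem _ _)]
      · intro ν _ hν
        rw [Finset.sum_eq_zero fun y _ => ?_, mul_zero]
        rw [hw, slice_localProjection, starProjection_of_mem_ne hν
          (Submodule.starProjection_apply_mem _ _), inner_zero_right]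
      · simp
    have h2 : 0 < star w ⬝ᵥ w := Matrix.dotProduct_star_self_pos_iff.2 h0
    have h3 := hX.dotProduct_mulVec_nonneg w
    have h4 := hX'.dotProduct_mulVec_nonneg w
    rw [Matrix.sub_mulVec, Matrix.one_mulVec, dotProduct_sub] at h4
    rw [h1] at h3 h4
    have h5 : 0 ≤ ζ μ := by
      by_contra h
      exact absurd (mul_nonneg h3 (inv_nonneg.2 h2.le)) (by
        rwa [mul_assoc, mul_inv_cancel₀ h2.ne', mul_one])
    have h6 : 0 ≤ 1 - ζ μ := by
      have h7 := mul_nonneg h4 (inv_nonneg.2 h2.le)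
      rwa [sub_mul, mul_assoc, mul_inv_cancel₀ h2.ne', mul_one] at h7
    rw [Complex.nonneg_iff] at h5 h6
    refine ⟨Complex.ext (by simp) (by simpa using h5.2), h5.1, ?_⟩
    simpa using h6.1
  -- If no symmetric vector meets the summand of `μ`, its scalar is unconstrained and its term
  -- vanishes; the value 0 serves.
  refine ⟨fun μ => if ∃ v : (Fin N → Fin d) × (Fin N → β) → ℂ,
    IsSymmetricVector v ∧ localProjection μ v ≠ 0 then (ζ μ).re else 0, fun μ => ?_,
    fun v hv => ?_⟩
  · dsimp only
    split_ifs with h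
    · obtain ⟨v, hv, h0⟩ := h
      exact (key μ v hv h0).2
    · exact ⟨le_rfl, zero_le_one⟩
  · rw [hζ v v hv hv]
    refine Finset.sum_congr rfl fun μ _ => ?_
    dsimp only
    split_ifs with h
    · obtain ⟨u, hu, h0⟩ := h
      rw [(key μ u hu h0).1]
    · have h0 : localProjection μ v = 0 := by
        by_contra h0
        exact h ⟨v, hv, h0⟩
      rw [Finset.sum_eq_zero fun y _ => ?_, mul_zero, mul_zero]
      rw [← slice_localProjection, h0]
      exact inner_zero_right _

end Symmetric

/-! ### Schmidt decompositions and local unitaries -/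

section Schmidt

variable {dA dB : ℕ}

/-- Singular value decomposition: for an eigenbasis `b` of `R R†`, the rows `b i† R` are orthogonal
with squared norms the eigenvalues. Those with eigenvalue 0 vanish and are dropped; the rest are
normalized by the square roots. -/
theorem HasEntanglementSpectrum.exists (ψ : BipartiteSpace dA dB) :
    ∃ S, HasEntanglementSpectrum ψ S := by
  classical
  let R : Matrix (Fin dA) (Fin dB) ℂ := Matrix.of fun a b => ψ (a, b)
  have hM : (R * R.conjTranspose).PosSemidef := Matrix.posSemidef_self_mul_conjTranspose R
  let b := hM.isHermitian.eigenvectorBasis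
  let ev := hM.isHermitian.eigenvalues
  let g : Fin dA → EuclideanSpace ℂ (Fin dB) := fun i =>
    WithLp.toLp 2 (Matrix.vecMul (star (b i).ofLp) R)
  have hg : ∀ i j, inner ℂ (g i) (g j) = if i = j then (ev i : ℂ) else 0 := by
    intro i j
    rw [EuclideanSpace.inner_eq_star_dotProduct]
    change Matrix.vecMul (star (b j).ofLp) R ⬝ᵥ star (Matrix.vecMul (star (b i).ofLp) R) = _
    rw [Matrix.star_vecMul, star_star, ← Matrix.dotProduct_mulVec, Matrix.mulVec_mulVec,
      hM.isHermitian.mulVec_eigenvectorBasis, dotProduct_smul, dotProduct_comm,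
      ← EuclideanSpace.inner_eq_star_dotProduct, orthonormal_iff_ite.1 b.orthonormal]
    by_cases h : i = j
    · simp [h, ev]
    · rw [if_neg h, if_neg (Ne.symm h), smul_zero]
  have hg0 : ∀ i, ev i = 0 → g i = 0 := by
    intro i hi
    rw [← inner_self_eq_zero (𝕜 := ℂ), hg, if_pos rfl, hi, Complex.ofReal_zero]
  have hev : ∀ i, 0 ≤ ev i := hM.eigenvalues_nonneg
  have hψ : ∀ a c, ψ (a, c) = ∑ i, b i a * g i c := by
    intro a c
    have h1 : (hM.isHermitian.eigenvectorUnitary : Matrix (Fin dA) (Fin dA) ℂ) *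
        star (hM.isHermitian.eigenvectorUnitary : Matrix (Fin dA) (Fin dA) ℂ) = 1 :=
      Matrix.mem_unitaryGroup_iff.1 hM.isHermitian.eigenvectorUnitary.2
    have h2 : (hM.isHermitian.eigenvectorUnitary : Matrix (Fin dA) (Fin dA) ℂ) *
        (star (hM.isHermitian.eigenvectorUnitary : Matrix (Fin dA) (Fin dA) ℂ) * R) = R := by
      rw [← Matrix.mul_assoc, h1, Matrix.one_mul]
    have h3 := congrFun (congrFun h2 a) c
    rw [Matrix.mul_apply] at h3
    exact h3.symm
  let ι := {i // ev i ≠ 0}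
  let e : Fin (Fintype.card ι) ≃ ι := (Fintype.equivFin ι).symm
  have hpos : ∀ i : ι, 0 < Real.sqrt (ev i) := fun i =>
    Real.sqrt_pos.2 (lt_of_le_of_ne (hev i) (Ne.symm i.2))
  have hsq : ∀ i : ι, ((Real.sqrt (ev i) : ℝ) : ℂ) * (Real.sqrt (ev i) : ℝ) = ev i := by
    intro i
    rw [← Complex.ofReal_mul, Real.mul_self_sqrt (hev i)]
  have hne : ∀ i : ι, ((Real.sqrt (ev i) : ℝ) : ℂ) ≠ 0 := fun i =>
    Complex.ofReal_ne_zero.2 (hpos i).ne'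
  refine ⟨_, Fintype.card ι, fun j => Real.sqrt (ev (e j)), fun j => b (e j).1,
    fun j => ((Real.sqrt (ev (e j)) : ℝ) : ℂ)⁻¹ • g (e j), ⟨?_, ?_, fun j => hpos (e j), ?_⟩, rfl⟩
  · exact b.orthonormal.comp _ (Subtype.val_injective.comp e.injective)
  · rw [orthonormal_iff_ite]
    intro i j
    rw [inner_smul_left, inner_smul_right, hg]
    by_cases h : i = j
    · subst h
      rw [if_pos rfl, if_pos rfl, ← hsq, map_inv₀, Complex.conj_ofReal]
      have := hne (e i)
      field_simp
    · rw [if_neg h, if_neg fun h' => h (e.injective (Subtype.ext h')), mul_zero, mul_zero]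
  · intro a c
    rw [hψ]
    have h1 : ∑ i, b i a * g i c = ∑ i : ι, b i.1 a * g i.1 c := by
      rw [← Finset.sum_subtype (Finset.univ.filter fun i => ev i ≠ 0) (by simp)
        (fun i => b i a * g i c), Finset.sum_filter_of_ne]
      intro i _ h hi
      exact h (by rw [hg0 i hi, PiLp.zero_apply, mul_zero])
    rw [h1, ← e.sum_comp]
    refine Finset.sum_congr rfl fun j _ => ?_
    rw [PiLp.smul_apply, smul_eq_mul]
    have := hne (e j)
    field_simp

/-- The action of local unitaries on bipartite states. -/
def localUnitary (U : Matrix (Fin dA) (Fin dA) ℂ) (V : Matrix (Fin dB) (Fin dB) ℂ)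
    (ψ : BipartiteSpace dA dB) : BipartiteSpace dA dB :=
  WithLp.toLp 2 ((U ⊗ₖ V).mulVec ψ.ofLp)

theorem orthonormal_mulVec {n ι : Type*} [Fintype n] [DecidableEq n] {U : Matrix n n ℂ}
    (hU : U ∈ Matrix.unitaryGroup n ℂ) {φ : ι → EuclideanSpace ℂ n} (hφ : Orthonormal ℂ φ) :
    Orthonormal ℂ fun j => WithLp.toLp 2 (U.mulVec (φ j).ofLp) := by
  classical
  rw [orthonormal_iff_ite] at *
  intro i j
  rw [← hφ i j, EuclideanSpace.inner_eq_star_dotProduct, EuclideanSpace.inner_eq_star_dotProduct]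
  change U.mulVec (φ j).ofLp ⬝ᵥ star (U.mulVec (φ i).ofLp) = _
  rw [Matrix.star_mulVec, dotProduct_comm, ← Matrix.dotProduct_mulVec, Matrix.mulVec_mulVec,
    ← Matrix.star_eq_conjTranspose, Matrix.mem_unitaryGroup_iff'.1 hU, Matrix.one_mulVec,
    dotProduct_comm]

theorem HasEntanglementSpectrum.localUnitary {ψ : BipartiteSpace dA dB} {S : Multiset ℝ}
    (h : HasEntanglementSpectrum ψ S) {U : Matrix (Fin dA) (Fin dA) ℂ}
    {V : Matrix (Fin dB) (Fin dB) ℂ} (hU : U ∈ Matrix.unitaryGroup (Fin dA) ℂ)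
    (hV : V ∈ Matrix.unitaryGroup (Fin dB) ℂ) :
    HasEntanglementSpectrum (localUnitary U V ψ) S := by
  obtain ⟨r, coef, φ, γ, ⟨hφ, hγ, hpos, hψ⟩, rfl⟩ := h
  refine ⟨r, coef, _, _, ⟨orthonormal_mulVec hU hφ, orthonormal_mulVec hV hγ, hpos, ?_⟩, rfl⟩
  intro a b
  change ∑ w, (U ⊗ₖ V) (a, b) w * ψ w = ∑ j, (coef j : ℂ) *
    ((∑ a', U a a' * φ j a') * ∑ b', V b b' * γ j b')
  simp only [Fintype.sum_prod_type, hψ, Matrix.kroneckerMap_apply, Finset.mul_sum, Finset.sum_mul]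
  rw [Finset.sum_congr rfl fun a' _ => Finset.sum_comm, Finset.sum_comm]
  refine Finset.sum_congr rfl fun j _ => ?_
  rw [Finset.sum_comm]
  refine Finset.sum_congr rfl fun b' _ => Finset.sum_congr rfl fun a' _ => ?_
  ring

theorem PureStateProperty.IsEntanglementSpectrumProperty.localUnitary_mem
    {P : PureStateProperty dA dB} (hP : P.IsEntanglementSpectrumProperty)
    {U : Matrix (Fin dA) (Fin dA) ℂ} {V : Matrix (Fin dB) (Fin dB) ℂ}
    (hU : U ∈ Matrix.unitaryGroup (Fin dA) ℂ) (hV : V ∈ Matrix.unitaryGroup (Fin dB) ℂ)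
    (ψ : BipartiteSpace dA dB) :
    (ψ ∈ P.yes → localUnitary U V ψ ∈ P.yes) ∧ (ψ ∈ P.no → localUnitary U V ψ ∈ P.no) := by
  obtain ⟨S, hS⟩ := HasEntanglementSpectrum.exists ψ
  exact hP ψ _ S hS (hS.localUnitary hU hV)

end Schmidt

/-! ### Testers that are invariant under local unitaries -/

theorem norm_toLp_matrix_sq {J : Type*} [Fintype J] (T : Matrix J J ℂ) :
    ‖(WithLp.toLp 2 fun p : J × J => T p.1 p.2 : EuclideanSpace ℂ (J × J))‖ ^ 2 =
      (T.conjTranspose * T).trace.re := by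
  rw [EuclideanSpace.norm_sq_eq, Fintype.sum_prod_type_right, Matrix.trace, Complex.re_sum]
  refine Finset.sum_congr rfl fun j _ => ?_
  rw [Matrix.diag_apply, Matrix.mul_apply, Complex.re_sum]
  refine Finset.sum_congr rfl fun i _ => ?_
  rw [Matrix.conjTranspose_apply, ← Complex.normSq_eq_norm_sq, RCLike.star_def,
    ← Complex.normSq_eq_conj_mul_self, Complex.ofReal_re]

/-- A nonempty closed convex set of matrices that is stable under conjugation by a set of unitaries
contains a matrix that is fixed by all these conjugations: the one of minimal Frobenius norm. -/
theorem exists_mem_forall_conj_eq {J : Type*} [Fintype J] [DecidableEq J] {K G : Set (Matrix J J ℂ)}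
    (hne : K.Nonempty) (hclosed : IsClosed K)
    (hmid : ∀ S ∈ K, ∀ T ∈ K, (1 / 2 : ℂ) • (S + T) ∈ K)
    (hG : ∀ W ∈ G, W ∈ Matrix.unitaryGroup J ℂ)
    (hK : ∀ W ∈ G, ∀ T ∈ K, W.conjTranspose * T * W ∈ K) :
    ∃ T ∈ K, ∀ W ∈ G, W.conjTranspose * T * W = T := by
  let Φ : EuclideanSpace ℂ (J × J) → Matrix J J ℂ := fun v => Matrix.of fun i j => v (i, j)
  let Ψ : Matrix J J ℂ → EuclideanSpace ℂ (J × J) := fun T => WithLp.toLp 2 fun p => T p.1 p.2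
  have hΦ : Continuous Φ := by
    refine continuous_matrix fun i j => ?_
    exact (continuous_apply (i, j)).comp (PiLp.continuous_ofLp 2 _)
  obtain ⟨T₀, hT₀⟩ := hne
  obtain ⟨v, hv, hmin⟩ := (hclosed.preimage hΦ).exists_infDist_eq_dist ⟨Ψ T₀, hT₀⟩ 0
  have hle : ∀ w, Φ w ∈ K → ‖v‖ ≤ ‖w‖ := by
    intro w hw
    have := Metric.infDist_le_dist_of_mem (x := 0) (show w ∈ Φ ⁻¹' K from hw)
    rwa [hmin, dist_zero_left, dist_zero_left] at this
  refine ⟨Φ v, hv, fun W hW => ?_⟩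
  set T := Φ v with hT
  have hWW : W * W.conjTranspose = 1 := Matrix.mem_unitaryGroup_iff.1 (hG W hW)
  have hnorm : ‖Ψ (W.conjTranspose * T * W)‖ = ‖v‖ := by
    have h1 : ‖Ψ (W.conjTranspose * T * W)‖ ^ 2 = ‖Ψ T‖ ^ 2 := by
      rw [norm_toLp_matrix_sq, norm_toLp_matrix_sq]
      congr 1
      calc ((W.conjTranspose * T * W).conjTranspose * (W.conjTranspose * T * W)).trace
          = (W.conjTranspose * (T.conjTranspose * (W * W.conjTranspose) * T * W)).trace := by
            simp only [Matrix.conjTranspose_mul, Matrix.conjTranspose_conjTranspose,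
              Matrix.mul_assoc]
        _ = (T.conjTranspose * T).trace := by
            rw [hWW, Matrix.mul_one, Matrix.trace_mul_comm, Matrix.mul_assoc, hWW, Matrix.mul_one]
    exact (sq_eq_sq₀ (norm_nonneg _) (norm_nonneg _)).1 h1
  have hmem := hmid T hv _ (hK W hW T hv)
  have h2 : ‖v‖ ≤ ‖(1 / 2 : ℂ) • (v + Ψ (W.conjTranspose * T * W))‖ := hle _ hmem
  rw [norm_smul] at h2
  -- The minimizer and its conjugate have equal norms and their midpoint lies in `K`, so it is no
  -- shorter. The parallelogram law then forces them to coincide.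
  have h3 := parallelogram_law_with_norm ℂ v (Ψ (W.conjTranspose * T * W))
  rw [hnorm] at h3
  have h4 : ‖v - Ψ (W.conjTranspose * T * W)‖ = 0 := by
    norm_num at h2
    nlinarith [norm_nonneg v, norm_nonneg (v - Ψ (W.conjTranspose * T * W)),
      norm_nonneg (v + Ψ (W.conjTranspose * T * W))]
  rw [norm_sub_eq_zero_iff] at h4
  exact (congrArg Φ h4).symm

theorem isClosed_setOf_posSemidef {J : Type*} [Fintype J] :
    IsClosed {T : Matrix J J ℂ | T.PosSemidef} := by
  simp only [Matrix.posSemidef_iff_dotProduct_mulVec, Set.ofPred_and, Set.ofPred_forall]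
  refine IsClosed.inter ?_ (isClosed_iInter fun x => ?_)
  · exact isClosed_eq (continuous_id.matrix_conjTranspose) continuous_id
  · exact isClosed_le continuous_const
      (continuous_const.dotProduct (continuous_id.matrix_mulVec continuous_const))

section Tester

variable {dA dB N : ℕ}

/-- The vector `ψ^{⊗N}`. -/
def powVector {ι : Type*} (N : ℕ) (ψ : EuclideanSpace ℂ ι) : (Fin N → ι) → ℂ :=
  fun x => ∏ i, ψ (x i)

theorem acceptProb_eq (T : GlobalOperator dA dB N) (ψ : BipartiteSpace dA dB) :
    acceptProb T ψ = (star (powVector N ψ) ⬝ᵥ T.mulVec (powVector N ψ)).re := by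
  rw [acceptProb]
  congr 1
  simp only [Matrix.trace, Matrix.diag_apply, Matrix.mul_apply, dotProduct, Matrix.mulVec,
    Finset.mul_sum]
  refine Finset.sum_congr rfl fun x _ => Finset.sum_congr rfl fun y _ => ?_
  simp only [tensorPower_apply, pureDensity, Matrix.of_apply, Finset.prod_mul_distrib,
    Pi.star_apply, powVector, star_prod]
  ring

theorem powVector_localUnitary (U : Matrix (Fin dA) (Fin dA) ℂ) (V : Matrix (Fin dB) (Fin dB) ℂ)
    (ψ : BipartiteSpace dA dB) :
    powVector N (localUnitary U V ψ) = (tensorPower (U ⊗ₖ V) N).mulVec (powVector N ψ) := by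
  funext x
  change ∏ i, ∑ w, (U ⊗ₖ V) (x i) w * ψ w = ∑ y, tensorPower (U ⊗ₖ V) N x y * powVector N ψ y
  rw [Finset.prod_univ_sum, Fintype.piFinset_univ]
  simp only [Finset.prod_mul_distrib]
  rfl

/-- Conjugating the tester amounts to rotating the state, which is where invariance of the property
enters. -/
theorem acceptProb_localUnitary (T : GlobalOperator dA dB N) (U : Matrix (Fin dA) (Fin dA) ℂ)
    (V : Matrix (Fin dB) (Fin dB) ℂ) (ψ : BipartiteSpace dA dB) :
    acceptProb ((tensorPower (U ⊗ₖ V) N).conjTranspose * T * tensorPower (U ⊗ₖ V) N) ψ =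
      acceptProb T (localUnitary U V ψ) := by
  rw [acceptProb_eq, acceptProb_eq, powVector_localUnitary, Matrix.star_mulVec,
    ← Matrix.dotProduct_mulVec, Matrix.mulVec_mulVec, Matrix.mulVec_mulVec, Matrix.mul_assoc]

theorem tensorPower_kronecker_mem_unitaryGroup {U : Matrix (Fin dA) (Fin dA) ℂ}
    {V : Matrix (Fin dB) (Fin dB) ℂ} (hU : U ∈ Matrix.unitaryGroup (Fin dA) ℂ)
    (hV : V ∈ Matrix.unitaryGroup (Fin dB) ℂ) :
    tensorPower (U ⊗ₖ V) N ∈ Matrix.unitaryGroup (Fin N → Fin dA × Fin dB) ℂ := by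
  rw [Matrix.mem_unitaryGroup_iff, Matrix.star_eq_conjTranspose] at *
  rw [← tensorPower_conjTranspose, ← tensorPower_mul, Matrix.conjTranspose_kronecker,
    ← Matrix.mul_kronecker_mul, hU, hV, Matrix.one_kronecker_one, tensorPower_one]

theorem acceptProb_smul_add (S T : GlobalOperator dA dB N) (ψ : BipartiteSpace dA dB) :
    acceptProb ((1 / 2 : ℂ) • (S + T)) ψ = (acceptProb S ψ + acceptProb T ψ) / 2 := by
  simp only [acceptProb, Matrix.smul_mul, Matrix.add_mul, Matrix.trace_smul, Matrix.trace_add]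
  rw [smul_eq_mul, show (1 / 2 : ℂ) = ((1 / 2 : ℝ) : ℂ) by norm_num, Complex.re_ofReal_mul,
    Complex.add_re]
  ring

theorem isClosed_setOf_isTester (P : PureStateProperty dA dB) (c s : ℝ) :
    IsClosed {T : GlobalOperator dA dB N | IsTester P c s N T} := by
  have hcont : ∀ ψ : BipartiteSpace dA dB,
      Continuous fun T : GlobalOperator dA dB N => acceptProb T ψ := fun ψ =>
    Complex.continuous_re.comp (continuous_id.matrix_mul continuous_const).matrix_trace
  simp only [IsTester, Set.ofPred_and, Set.ofPred_forall]
  refine isClosed_setOf_posSemidef.inter (IsClosed.inter ?_ (IsClosed.inter ?_ ?_))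
  · exact isClosed_setOf_posSemidef.preimage
      (f := fun T : GlobalOperator dA dB N => 1 - T) (continuous_const.sub continuous_id)
  · exact isClosed_iInter fun ψ => isClosed_iInter fun _ => isClosed_le continuous_const (hcont ψ)
  · exact isClosed_iInter fun ψ => isClosed_iInter fun _ => isClosed_le (hcont ψ) continuous_const

theorem IsTester.midpoint {P : PureStateProperty dA dB} {c s : ℝ} {S T : GlobalOperator dA dB N}
    (hS : IsTester P c s N S) (hT : IsTester P c s N T) :
    IsTester P c s N ((1 / 2 : ℂ) • (S + T)) := by
  have h2 : (0 : ℂ) ≤ 1 / 2 := by positivity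
  refine ⟨(hS.1.add hT.1).smul h2, ?_, fun ψ hψ => ?_, fun ψ hψ => ?_⟩
  · have h : 1 - (1 / 2 : ℂ) • (S + T) = (1 / 2 : ℂ) • ((1 - S) + (1 - T)) := by
      module
    rw [h]
    exact (hS.2.1.add hT.2.1).smul h2
  · rw [acceptProb_smul_add]
    linarith [hS.2.2.1 ψ hψ, hT.2.2.1 ψ hψ]
  · rw [acceptProb_smul_add]
    linarith [hS.2.2.2 ψ hψ, hT.2.2.2 ψ hψ]

/-- A property of the entanglement spectrum that has a tester has one that commutes with
`U^{⊗N} ⊗ V^{⊗N}` for all unitary `U` and `V`. -/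
theorem exists_isTester_commute {P : PureStateProperty dA dB}
    (hP : P.IsEntanglementSpectrumProperty) {c s : ℝ}
    (h : ∃ T : GlobalOperator dA dB N, IsTester P c s N T) :
    ∃ T : GlobalOperator dA dB N, IsTester P c s N T ∧
      ∀ U ∈ Matrix.unitaryGroup (Fin dA) ℂ, ∀ V ∈ Matrix.unitaryGroup (Fin dB) ℂ,
        Commute T (tensorPower (U ⊗ₖ V) N) := by
  obtain ⟨T, hT, hinv⟩ := exists_mem_forall_conj_eq
    (K := {T : GlobalOperator dA dB N | IsTester P c s N T})
    (G := {W | ∃ U ∈ Matrix.unitaryGroup (Fin dA) ℂ, ∃ V ∈ Matrix.unitaryGroup (Fin dB) ℂ,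
      W = tensorPower (U ⊗ₖ V) N}) h (isClosed_setOf_isTester P c s)
    (fun S hS T hT => IsTester.midpoint hS hT)
    (by
      rintro _ ⟨U, hU, V, hV, rfl⟩
      exact tensorPower_kronecker_mem_unitaryGroup hU hV)
    (by
      rintro _ ⟨U, hU, V, hV, rfl⟩ T hT
      have hWW : (tensorPower (U ⊗ₖ V) N).conjTranspose * tensorPower (U ⊗ₖ V) N = 1 :=
        Matrix.mem_unitaryGroup_iff'.1 (tensorPower_kronecker_mem_unitaryGroup hU hV)
      refine ⟨hT.1.conjTranspose_mul_mul_same _, ?_, fun ψ hψ => ?_, fun ψ hψ => ?_⟩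
      · have h1 := hT.2.1.conjTranspose_mul_mul_same (tensorPower (U ⊗ₖ V) N)
        rwa [Matrix.mul_sub, Matrix.sub_mul, Matrix.mul_one, hWW] at h1
      · rw [acceptProb_localUnitary]
        exact hT.2.2.1 _ ((hP.localUnitary_mem hU hV ψ).1 hψ)
      · rw [acceptProb_localUnitary]
        exact hT.2.2.2 _ ((hP.localUnitary_mem hU hV ψ).2 hψ))
  refine ⟨T, hT, fun U hU V hV => ?_⟩
  have hWW : tensorPower (U ⊗ₖ V) N * (tensorPower (U ⊗ₖ V) N).conjTranspose = 1 :=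
    Matrix.mem_unitaryGroup_iff.1 (tensorPower_kronecker_mem_unitaryGroup hU hV)
  have h1 := congrArg (fun M => tensorPower (U ⊗ₖ V) N * M) (hinv _ ⟨U, hU, V, hV, rfl⟩)
  simp only [← Matrix.mul_assoc, hWW, Matrix.one_mul] at h1
  exact h1

end Tester

/-! ### Local weak Schur sampling -/

theorem weakSchurSampling_mulVec {N d : ℕ} (μ : BoundedDiagram N d)
    (v : EuclideanSpace ℂ (Fin N → Fin d)) :
    (weakSchurSampling N d μ).mulVec v.ofLp = ((schurWeylSummand μ).starProjection v).ofLp := by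
  rw [weakSchurSampling, ← Matrix.ofLp_toEuclideanCLM, StarAlgEquiv.apply_symm_apply]

theorem posSemidef_weakSchurSampling {N d : ℕ} (μ : BoundedDiagram N d) :
    (weakSchurSampling N d μ).PosSemidef := by
  have h := isStarProjection_starProjection (U := schurWeylSummand μ)
  have h1 : (weakSchurSampling N d μ).conjTranspose * weakSchurSampling N d μ =
      weakSchurSampling N d μ := by
    apply EquivLike.injective (Matrix.toEuclideanCLM (n := Fin N → Fin d) (𝕜 := ℂ))
    rw [← Matrix.star_eq_conjTranspose, map_mul, map_star, weakSchurSampling,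
      StarAlgEquiv.apply_symm_apply, h.isSelfAdjoint.star_eq, h.isIdempotentElem.eq]
  rw [← h1]
  exact Matrix.posSemidef_conjTranspose_mul_self _

/-- Weak Schur sampling is a measurement. -/
theorem isMeasurement_weakSchurSampling (N d : ℕ) : IsMeasurement (weakSchurSampling N d) := by
  refine ⟨posSemidef_weakSchurSampling, ?_⟩
  simp only [weakSchurSampling]
  rw [← map_sum, ← map_one (Matrix.toEuclideanCLM (n := Fin N → Fin d) (𝕜 := ℂ)).symm]
  congr 1
  ext1 v
  rw [sum_apply, sum_starProjection_schurWeylSummand]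
  rfl

section LocalOperator

variable {dA dB N : ℕ}

/-- The identification of `(ℂ^dA ⊗ ℂ^dB)^{⊗N}` with `(ℂ^dA)^{⊗N} ⊗ (ℂ^dB)^{⊗N}`. -/
abbrev wordsEquiv (dA dB N : ℕ) :
    (Fin N → Fin dA × Fin dB) ≃ (Fin N → Fin dA) × (Fin N → Fin dB) :=
  Equiv.arrowProdEquivProdArrow (Fin N) (fun _ => Fin dA) (fun _ => Fin dB)

theorem localOperator_eq (M : Matrix (Fin N → Fin dA) (Fin N → Fin dA) ℂ) :
    localOperator dB M = (M ⊗ₖ 1).submatrix (wordsEquiv dA dB N) (wordsEquiv dA dB N) := rfl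

theorem tensorPower_kronecker (U : Matrix (Fin dA) (Fin dA) ℂ) (V : Matrix (Fin dB) (Fin dB) ℂ) :
    tensorPower (U ⊗ₖ V) N = (tensorPower U N ⊗ₖ tensorPower V N).submatrix
      (wordsEquiv dA dB N) (wordsEquiv dA dB N) := by
  ext x y
  simp only [tensorPower_apply, Matrix.submatrix_apply, Matrix.kroneckerMap_apply,
    Finset.prod_mul_distrib]
  rfl

theorem acceptProb_submatrix
    (X : Matrix ((Fin N → Fin dA) × (Fin N → Fin dB)) ((Fin N → Fin dA) × (Fin N → Fin dB)) ℂ)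
    (ψ : BipartiteSpace dA dB) :
    acceptProb (X.submatrix (wordsEquiv dA dB N) (wordsEquiv dA dB N)) ψ =
      (star (powVector N ψ ∘ (wordsEquiv dA dB N).symm) ⬝ᵥ
        X.mulVec (powVector N ψ ∘ (wordsEquiv dA dB N).symm)).re := by
  rw [acceptProb_eq, Matrix.submatrix_mulVec_equiv, ← comp_equiv_symm_dotProduct]
  rfl

theorem isSymmetricVector_powVector (ψ : BipartiteSpace dA dB) :
    IsSymmetricVector (powVector N ψ ∘ (wordsEquiv dA dB N).symm) := by
  intro g w
  exact Equiv.prod_comp g fun i => ψ (w.1 i, w.2 i)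

theorem posSemidef_localOperator {M : Matrix (Fin N → Fin dA) (Fin N → Fin dA) ℂ}
    (hM : M.PosSemidef) : (localOperator dB M).PosSemidef :=
  (hM.kronecker Matrix.PosSemidef.one).submatrix _

theorem one_sub_localOperator (M : Matrix (Fin N → Fin dA) (Fin N → Fin dA) ℂ) :
    1 - localOperator dB M = localOperator dB (1 - M) := by
  have h : (1 : GlobalOperator dA dB N) =
      (1 : Matrix ((Fin N → Fin dA) × (Fin N → Fin dB)) _ ℂ).submatrix
        (wordsEquiv dA dB N) (wordsEquiv dA dB N) := (Matrix.submatrix_one_equiv _).symm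
  have h' : ((1 - M) ⊗ₖ (1 : Matrix (Fin N → Fin dB) (Fin N → Fin dB) ℂ)) + M ⊗ₖ 1 = 1 := by
    rw [← Matrix.add_kronecker, sub_add_cancel, Matrix.one_kronecker_one]
  rw [sub_eq_iff_eq_add, localOperator_eq, localOperator_eq, h, ← h']
  rfl

theorem dotProduct_kronecker_one_mulVec (M : Matrix (Fin N → Fin dA) (Fin N → Fin dA) ℂ)
    (v : (Fin N → Fin dA) × (Fin N → Fin dB) → ℂ) :
    star v ⬝ᵥ (M ⊗ₖ 1).mulVec v =
      ∑ y, inner ℂ (slice v y) (WithLp.toLp 2 (M.mulVec (slice v y).ofLp)) := by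
  rw [dotProduct, Fintype.sum_prod_type_right]
  refine Finset.sum_congr rfl fun y _ => ?_
  rw [PiLp.inner_apply]
  refine Finset.sum_congr rfl fun x _ => ?_
  rw [RCLike.inner_apply, mul_comm]
  congr 1
  simp [Matrix.mulVec, dotProduct, Fintype.sum_prod_type, Matrix.one_apply, slice]

theorem acceptProb_localOperator_weakSchur (f : BoundedDiagram N dA → ℝ)
    (ψ : BipartiteSpace dA dB) :
    acceptProb (localOperator dB (∑ μ, (f μ : ℂ) • weakSchurSampling N dA μ)) ψ =
      (∑ μ, (f μ : ℂ) * ∑ y, inner ℂ (slice (powVector N ψ ∘ (wordsEquiv dA dB N).symm) y)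
        ((schurWeylSummand μ).starProjection
          (slice (powVector N ψ ∘ (wordsEquiv dA dB N).symm) y))).re := by
  rw [localOperator_eq, acceptProb_submatrix, dotProduct_kronecker_one_mulVec]
  congr 1
  simp only [Finset.mul_sum]
  rw [Finset.sum_comm]
  refine Finset.sum_congr rfl fun y _ => ?_
  rw [Matrix.sum_mulVec, WithLp.toLp_sum, inner_sum]
  refine Finset.sum_congr rfl fun μ _ => ?_
  rw [Matrix.smul_mulVec, weakSchurSampling_mulVec, WithLp.toLp_smul, inner_smul_right]

/-- A property of the entanglement spectrum that has a tester has a tester of the same sample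
complexity that performs local weak Schur sampling. -/
theorem exists_isTester_isLocalWeakSchurTester {P : PureStateProperty dA dB}
    (hP : P.IsEntanglementSpectrumProperty) {c s : ℝ}
    (h : ∃ T : GlobalOperator dA dB N, IsTester P c s N T) :
    ∃ T : GlobalOperator dA dB N, IsTester P c s N T ∧ IsLocalWeakSchurTester T := by
  obtain ⟨T, hT, hcomm⟩ := exists_isTester_commute hP h
  set e := wordsEquiv dA dB N with he
  set X := T.submatrix e.symm e.symm with hX
  have hTX : T = X.submatrix e e := by simp [hX]
  have hXcomm : ∀ U ∈ Matrix.unitaryGroup (Fin dA) ℂ, ∀ V ∈ Matrix.unitaryGroup (Fin dB) ℂ,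
      Commute X (tensorPower U N ⊗ₖ tensorPower V N) := by
    intro U hU V hV
    have h1 := (hcomm U hU V hV).eq
    rw [tensorPower_kronecker, hTX, Matrix.submatrix_mul_equiv, Matrix.submatrix_mul_equiv] at h1
    exact (Matrix.reindex e.symm e.symm).injective h1
  obtain ⟨f, hf, hfv⟩ := exists_acceptance_probabilities (X := X) (hT.1.submatrix _)
    (by
      have h1 := hT.2.1.submatrix e.symm
      rwa [Matrix.submatrix_sub, Pi.sub_apply, Pi.sub_apply, Matrix.submatrix_one_equiv] at h1)
    -- Taking one of the two unitaries to be 1 separates the parties.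
    (fun U hU => by simpa only [tensorPower_one] using hXcomm U hU 1 (one_mem _))
    (fun U hU => by simpa only [tensorPower_one] using hXcomm 1 (one_mem _) U hU)
  -- Equality is claimed only on the vectors `ψ^{⊗N}`, which are symmetric; the two operators may
  -- differ elsewhere.
  have hacc : ∀ ψ, acceptProb (localOperator dB (∑ μ, (f μ : ℂ) • weakSchurSampling N dA μ)) ψ =
      acceptProb T ψ := by
    intro ψ
    rw [acceptProb_localOperator_weakSchur, ← hfv _ (isSymmetricVector_powVector ψ), hTX,
      acceptProb_submatrix]
  have hmeas := isMeasurement_weakSchurSampling N dA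
  refine ⟨_, ⟨?_, ?_, fun ψ hψ => ?_, fun ψ hψ => ?_⟩, _, ⟨hmeas, f, hf, rfl⟩, rfl⟩
  · refine posSemidef_localOperator (Matrix.posSemidef_sum _ fun μ _ => (hmeas.1 μ).smul ?_)
    exact Complex.zero_le_real.2 (hf μ).1
  · have h1 : 1 - ∑ μ, (f μ : ℂ) • weakSchurSampling N dA μ =
        ∑ μ, ((1 - f μ : ℝ) : ℂ) • weakSchurSampling N dA μ := by
      rw [← hmeas.2, ← Finset.sum_sub_distrib]
      refine Finset.sum_congr rfl fun μ _ => ?_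
      rw [Complex.ofReal_sub, Complex.ofReal_one, sub_smul, one_smul]
    rw [one_sub_localOperator, h1]
    refine posSemidef_localOperator (Matrix.posSemidef_sum _ fun μ _ => (hmeas.1 μ).smul ?_)
    exact Complex.zero_le_real.2 (sub_nonneg.2 (hf μ).2)
  · rw [hacc]
    exact hT.2.2.1 ψ hψ
  · rw [hacc]
    exact hT.2.2.2 ψ hψ

end LocalOperator

end

/-! ### The corollary -/

theorem corollary1p4 (dA dB : ℕ) (P : PureStateProperty dA dB)
    (hP : P.IsEntanglementSpectrumProperty) (c s : ℝ) (hs : 0 ≤ s) (hsc : s < c) (hc : c ≤ 1) :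
    (∀ N : ℕ, (∃ T : GlobalOperator dA dB N, IsTester P c s N T) →
      ∃ T : GlobalOperator dA dB N, IsTester P c s N T ∧ IsLocalWeakSchurTester T) ∧
    (sampleComplexity P c s ≠ ⊤ →
      ∃ (N : ℕ) (T : GlobalOperator dA dB N), (N : ℕ∞) = sampleComplexity P c s ∧
        IsTester P c s N T ∧ IsLocalWeakSchurTester T) := by
  refine ⟨fun N h => exists_isTester_isLocalWeakSchurTester hP h, fun h => ?_⟩
  have hne : {n : ℕ∞ | ∃ (N : ℕ) (T : GlobalOperator dA dB N),
      n = N ∧ IsTester P c s N T}.Nonempty := by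
    by_contra hne
    rw [Set.not_nonempty_iff_eq_empty] at hne
    exact h (by rw [sampleComplexity, hne, sInf_empty])
  -- A nonempty set in the well-ordered `ℕ∞` attains its infimum.
  obtain ⟨N, T, hN, hT⟩ := csInf_mem hne
  obtain ⟨T', hT', hT''⟩ := exists_isTester_isLocalWeakSchurTester hP ⟨T, hT⟩
  exact ⟨N, T', hN.symm, hT', hT''⟩
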